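/- **Setting.** For $f:\mathbb R\to\mathbb R$ in $L^1(\mathbb R)$ write $\widehat f(\omega)=\int f(x)e^{-ix\omega}\,dx$ and $(Pf)(\omega)=|\widehat f(\omega)|^2$. Let $f\in L^2(\mathbb R)$ be real-valued and compactly supported. In the *noisy dilation MRA model* with parameters $\eta,\sigma,M$ (where $0<\eta$, $\eta^2\le\frac1{12}$, $\sigma\ge 0$, $M\ge1$) one has $M$ independent observations $$y_j(x)=f_j(x)+\varepsilon_j(x),\qquad f_j(x)=f\big((1-\tau_j)^{-1}(x-t_j)\big),\qquad 1\le j\le M,$$ where the $t_j$ are copies of a real random variable; the $\tau_j$ are uniformly distributed on an interval with $\mathbb E\tau_j=0$ and $\operatorname{Var}\tau_j=\eta^2$; the $\varepsilon_j$ are Gaussian white noise processes on $[-\frac12,\frac12]$ with variance $\sigma^2$, and $\varepsilon_j$ is independent of $(t_j,\tau_j)$; and almost surely $y_j$ is supported in $[-\frac12,\frac12]$. Put $\widehat\varepsilon_j(\omega)=\int_{-1/2}^{1/2}e^{-ix\omega}\varepsilon_j(x)\,dx$ (a Wiener integral, in a jointly measurable version), $\widehat y_j=\widehat f_j+\widehat\varepsilon_j$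 and $Py_j=|\widehat y_j|^2$. **Estimator.** Let $(L_Cu)(\omega)=C^3u(C\omega)$, $C_0=\frac{1-\sqrt3\,\eta}{1+\sqrt3\,\eta}$, $C_1=2\sqrt3\,\eta$, $C_2=\frac1{1+\sqrt3\,\eta}$, and $\phi_L(\omega)=(2\pi L^2)^{-1/2}e^{-\omega^2/(2L^2)}$ for $L>0$. With $G=\big(\frac1M\sum_{j=1}^M Py_j-\sigma^2\big)*\phi_L$, define $$\widetilde{Pf}=(I-L_{C_0})^{-1}C_1L_{C_2}\big[3G(\omega)+\omega G'(\omega)\big],$$ where $(I-L_{C_0})^{-1}=\sum_{i\ge0}L_{C_0}^i$, evaluated pointwise. **Theorem 2.** Assume that $Pf\in C^3(\mathbb R)$ and that for $k=2,3$ the function $$\omega\mapsto\omega^k\max_{\xi}\big|(Pf)^{(k)}(\xi)\big|,$$ with the maximum over $\xi$ between $\omega/2$ and $2\omega$, belongs to $L^2(\mathbb R)$. Let $\Omega\subset\mathbb R$ be a bounded interval and let $L_0>0$. Then there is a constant $C_{f,\Omega}>0$, depending only on $f$, $\Omega$ and $L_0$ (and not on $\eta,\sigma,M,L$, the law of the $t_j$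 or the probability space), such that for every noisy dilation MRA model as above and every $0<L\le L_0$ the estimator $\widetilde{Pf}$ is almost surely well defined (the convolution integrals and the Neumann series converge at every frequency and $G$ is differentiable) and $$\mathbb E\Big[\|Pf-\widetilde{Pf}\|_{L^2(\Omega)}^2\Big]\le C_{f,\Omega}\left(\frac{\eta^2}{M}+L^4+\frac{\sigma^2\vee\sigma^4}{L^2M}\right).$$ -/

import Mathlib

open MeasureTheory ProbabilityTheory Filter Topology

noncomputable section

namespace DilationMRA

/-! ### Signals, Fourier transform, power spectrum -/

/-- The Fourier transform `f̂(ω) = ∫ f(x) e^{-ixω} dx` of a real signal. -/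
def hat (f : ℝ → ℝ) (ω : ℝ) : ℂ :=
  ∫ x : ℝ, (f x : ℂ) * Complex.exp (-(Complex.I * (x : ℂ) * (ω : ℂ)))

/-- The power spectrum `(Pf)(ω) = |f̂(ω)|²`. -/
def powerSpectrum (f : ℝ → ℝ) (ω : ℝ) : ℝ := ‖hat f ω‖ ^ 2

/-- The translated and dilated signal `x ↦ f((1 - τ)⁻¹ (x - t))`. -/
def dilatedSignal (f : ℝ → ℝ) (τ t : ℝ) (x : ℝ) : ℝ := f ((1 - τ)⁻¹ * (x - t))

/-- The maximal function `ω ↦ max_{ξ between ω/2 and 2ω} |g⁽ᵏ⁾(ξ)|`; for negative `ω` the interval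
between `ω / 2` and `2 ω` is `[2ω, ω/2]`. -/
def maxDeriv (g : ℝ → ℝ) (k : ℕ) (ω : ℝ) : ℝ :=
  sSup ((fun ξ => |iteratedDeriv k g ξ|) '' Set.uIcc (ω / 2) (2 * ω))

/-! ### White noise on `[-1/2, 1/2]` -/

/-- Lebesgue measure on the box `[-1/2, 1/2]`. -/
abbrev boxMeasure : Measure ℝ := volume.restrict (Set.Icc (-(1 / 2) : ℝ) (1 / 2))

lemma memLp_cos (ω : ℝ) : MemLp (fun x : ℝ => Real.cos (x * ω)) 2 boxMeasure :=
  MemLp.of_bound (by fun_prop) 1 (Eventually.of_forall fun x => by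
    simpa using Real.abs_cos_le_one (x * ω))

lemma memLp_sin (ω : ℝ) : MemLp (fun x : ℝ => Real.sin (x * ω)) 2 boxMeasure :=
  MemLp.of_bound (by fun_prop) 1 (Eventually.of_forall fun x => by
    simpa using Real.abs_sin_le_one (x * ω))

/-- The function `x ↦ cos(xω)` in `L²([-1/2, 1/2])`. -/
def cosLp (ω : ℝ) : Lp ℝ 2 boxMeasure := (memLp_cos ω).toLp _

/-- The function `x ↦ sin(xω)` in `L²([-1/2, 1/2])`. -/
def sinLp (ω : ℝ) : Lp ℝ 2 boxMeasure := (memLp_sin ω).toLp _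

/-- (Gaussian) white noise on `[-1/2, 1/2]` with variance `σ²`, as a generalized process
`h ↦ W h = ∫ h(x) ε(x) dx`: it is linear in `h ∈ L²([-1/2, 1/2])`, and each `W h` is a centred
Gaussian variable of variance `σ² ‖h‖²`. -/
def IsWhiteNoise {S : Type*} [MeasurableSpace S] (P : Measure S) (σ : ℝ)
    (W : Lp ℝ 2 boxMeasure →ₗ[ℝ] Lp ℝ 2 P) : Prop :=
  ∀ h : Lp ℝ 2 boxMeasure,
    P.map (W h : S → ℝ) = gaussianReal 0 (Real.toNNReal (σ ^ 2 * ‖h‖ ^ 2))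

/-- `e` is (a jointly measurable version of) the Fourier transform of the white noise `W`:
`e ω = W(e^{-i·ω}) = W(cos(·ω)) - i W(sin(·ω))`. Each frequency determines `e ω` almost surely, so
two versions agree at almost every frequency, almost surely. -/
structure IsNoiseFourier {S : Type*} [MeasurableSpace S] (P : Measure S)
    (W : Lp ℝ 2 boxMeasure →ₗ[ℝ] Lp ℝ 2 P) (e : ℝ → S → ℂ) : Prop where
  measurable : Measurable (Function.uncurry e)
  ae_eq : ∀ ω : ℝ, e ω =ᵐ[P] fun s =>
    (((W (cosLp ω) : S → ℝ) s : ℝ) : ℂ) - Complex.I * (((W (sinLp ω) : S → ℝ) s : ℝ) : ℂ)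

/-! ### The noisy dilation model -/

/-- The noisy dilation model with `M` independent observations
`y_j(x) = f((1 - τ_j)⁻¹ (x - t_j)) + ε_j(x)`. The noise `ε_j` is the generalized process `W j`,
with Fourier transform `e j`. No independence between `t_j` and `τ_j` is required. -/
structure NoisyDilationModel {S : Type*} [MeasurableSpace S] (P : Measure S)
    (f : ℝ → ℝ) (η σ : ℝ) (M : ℕ) (t τ : Fin M → S → ℝ)
    (W : Fin M → (Lp ℝ 2 boxMeasure →ₗ[ℝ] Lp ℝ 2 P)) (e : Fin M → ℝ → S → ℂ) : Prop where
  measurable_t : ∀ j, Measurable (t j)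
  measurable_τ : ∀ j, Measurable (τ j)
  /-- the `M` observations are independent -/
  indep : iIndepFun (fun (j : Fin M) (s : S) =>
    (t j s, τ j s, fun h : Lp ℝ 2 boxMeasure => (W j h : S → ℝ) s)) P
  /-- the noise is independent of the translation and the dilation -/
  indep_noise : ∀ j, IndepFun (fun s => (t j s, τ j s))
    (fun s => fun h : Lp ℝ 2 boxMeasure => (W j h : S → ℝ) s) P
  /-- the translations have a common law -/
  identDistrib_t : ∀ i j, IdentDistrib (t i) (t j) P P
  /-- the dilation parameters are uniform on an interval, with mean `0` and variance `η²` -/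
  uniform_τ : ∀ j, ∃ a b : ℝ, a < b ∧ pdf.IsUniform (τ j) (Set.Icc a b) P volume
  mean_τ : ∀ j, ∫ s, τ j s ∂P = 0
  variance_τ : ∀ j, variance (τ j) P = η ^ 2
  whiteNoise : ∀ j, IsWhiteNoise P σ (W j)
  noiseFourier : ∀ j, IsNoiseFourier P (W j) (e j)
  /-- the observations are supported in the box (the noise is by definition) -/
  support : ∀ j, ∀ᵐ s ∂P, ∀ᵐ x : ℝ,
    x ∉ Set.Icc (-(1 / 2) : ℝ) (1 / 2) → dilatedSignal f (τ j s) (t j s) x = 0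

/-- The Fourier transforms `ŷ_j = f̂_j + ε̂_j` of the observations at the sample point `s`. -/
def obsHat {S : Type*} (f : ℝ → ℝ) {M : ℕ} (t τ : Fin M → S → ℝ) (e : Fin M → ℝ → S → ℂ)
    (s : S) (j : Fin M) (ω : ℝ) : ℂ :=
  hat (dilatedSignal f (τ j s) (t j s)) ω + e j ω s

/-! ### The estimator -/

/-- The dilation operator `(L_C u)(ω) = C³ u(Cω)`. -/
def dilate (C : ℝ) (u : ℝ → ℝ) : ℝ → ℝ := fun ω => C ^ 3 * u (C * ω)

/-- `(I - L_C)⁻¹`, given by the Neumann series `u + L_C u + L_C² u + ⋯`, evaluated pointwise. -/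
def invOneSubDilate (C : ℝ) (u : ℝ → ℝ) : ℝ → ℝ := fun ω => ∑' i : ℕ, ((dilate C)^[i] u) ω

lemma iterate_dilate (C : ℝ) (u : ℝ → ℝ) (i : ℕ) (ω : ℝ) :
    ((dilate C)^[i] u) ω = (C ^ i) ^ 3 * u (C ^ i * ω) := by
  induction i generalizing ω with
  | zero => simp
  | succ n ih =>
    rw [Function.iterate_succ_apply', dilate, ih]
    rw [pow_succ]
    ring_nf

/-- Where the Neumann series converges it inverts `I - L_C`. -/
lemma invOneSubDilate_sub_dilate (C : ℝ) (u : ℝ → ℝ)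
    (hu : ∀ ω, Summable fun i : ℕ => ((dilate C)^[i] u) ω) :
    invOneSubDilate C u - dilate C (invOneSubDilate C u) = u := by
  funext ω
  have h := (hu ω).tsum_eq_zero_add
  have h2 : dilate C (invOneSubDilate C u) ω = ∑' i : ℕ, ((dilate C)^[i + 1] u) ω := by
    simp only [dilate, invOneSubDilate]
    rw [← tsum_mul_left]
    refine tsum_congr fun i => ?_
    rw [Function.iterate_succ_apply']
    rfl
  simp only [Pi.sub_apply, h2]
  simp only [invOneSubDilate]
  rw [h]
  simp

/-- For `0 ≤ C < 1`, `I - L_C` is injective on functions that are continuous at `0`. -/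
lemma eq_zero_of_eq_dilate (C : ℝ) (h0 : 0 ≤ C) (h1 : C < 1) (u : ℝ → ℝ)
    (hc : ContinuousAt u 0) (hu : u = dilate C u) : u = 0 := by
  have hit : ∀ i : ℕ, (dilate C)^[i] u = u := fun i => by
    induction i with
    | zero => rfl
    | succ n ih => rw [Function.iterate_succ_apply', ih, ← hu]
  funext ω
  have hp := tendsto_pow_atTop_nhds_zero_of_lt_one h0 h1
  have h2 : Tendsto (fun i : ℕ => (C ^ i) ^ 3 * u (C ^ i * ω)) atTop (𝓝 (0 ^ 3 * u 0)) := by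
    refine (hp.pow 3).mul (hc.tendsto.comp ?_)
    simpa using hp.mul_const ω
  have h3 : (fun i : ℕ => (C ^ i) ^ 3 * u (C ^ i * ω)) = fun _ => u ω := by
    funext i
    rw [← iterate_dilate, hit]
  rw [h3] at h2
  simpa using tendsto_nhds_unique tendsto_const_nhds h2

/-- `C₀ = (1 - √3 η) / (1 + √3 η)`. -/
def c0 (η : ℝ) : ℝ := (1 - √3 * η) / (1 + √3 * η)

/-- `C₁ = 2 √3 η`. -/
def c1 (η : ℝ) : ℝ := 2 * √3 * η

/-- `C₂ = 1 / (1 + √3 η)`. -/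
def c2 (η : ℝ) : ℝ := 1 / (1 + √3 * η)

/-- The Gaussian filter `φ_L(ω) = (2πL²)^{-1/2} e^{-ω²/(2L²)}`. -/
def gaussianFilter (L ω : ℝ) : ℝ :=
  (√(2 * Real.pi * L ^ 2))⁻¹ * Real.exp (-(ω ^ 2 / (2 * L ^ 2)))

/-- The noise-debiased mean power spectrum `(1/M) ∑_j |ŷ_j(ω)|² - σ²`. -/
def debiasedMean {M : ℕ} (σ : ℝ) (yhat : Fin M → ℝ → ℂ) (ω : ℝ) : ℝ :=
  (M : ℝ)⁻¹ * ∑ j, ‖yhat j ω‖ ^ 2 - σ ^ 2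

/-- The debiased mean power spectrum convolved with the Gaussian filter of width `L`. -/
def smoothedMean {M : ℕ} (σ L : ℝ) (yhat : Fin M → ℝ → ℂ) : ℝ → ℝ :=
  convolution (debiasedMean σ yhat) (gaussianFilter L) (ContinuousLinearMap.mul ℝ ℝ) volume

/-- The data term `C₁ L_{C₂} [3 G(ω) + ω G'(ω)]`, where `G` is the smoothed mean. -/
def dataTerm {M : ℕ} (η σ L : ℝ) (yhat : Fin M → ℝ → ℂ) : ℝ → ℝ := fun ω =>
  c1 η * dilate (c2 η)
    (fun ω' => 3 * smoothedMean σ L yhat ω' + ω' * deriv (smoothedMean σ L yhat) ω') ω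

/-- The estimator `P̃f = (I - L_{C₀})⁻¹ C₁ L_{C₂} [3 G(ω) + ω G'(ω)]`. -/
def estimator {M : ℕ} (η σ L : ℝ) (yhat : Fin M → ℝ → ℂ) : ℝ → ℝ :=
  invOneSubDilate (c0 η) (dataTerm η σ L yhat)

/-- The estimator is well defined on the data `yhat`: the convolution integrals converge, the
smoothed mean is differentiable, and the Neumann series converges at every frequency. -/
structure EstimatorDefined {M : ℕ} (η σ L : ℝ) (yhat : Fin M → ℝ → ℂ) : Prop where
  convolutionExists : ConvolutionExists (debiasedMean σ yhat) (gaussianFilter L)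
    (ContinuousLinearMap.mul ℝ ℝ) volume
  differentiable : Differentiable ℝ (smoothedMean σ L yhat)
  summable : ∀ ω, Summable fun i : ℕ => ((dilate (c0 η))^[i] (dataTerm η σ L yhat)) ω

end DilationMRA

end

/-!
# Mean square error of the unbiased estimator in the noisy dilation model

Write `g = Pf`, `h = √3 η ≤ 1/2` and `u_τ(x) = (1 - τ)² g((1 - τ) x)`, the power spectrum of the
signal dilated by `1 - τ` (translations do not change it). As `f` is integrable with compact
support, `g` and its first three derivatives are bounded (`exists_hasBoundedDerivs`).

*Unbiasing.* The dilations are uniform on `[-h, h]`, and `3 u_τ(ω) + ω u_τ'(ω)` is the derivative of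
`-(1 - τ)³ g((1 - τ) ω)` with respect to `τ`. Hence its mean over `τ` is
`(2h)⁻¹ ((1 + h)³ g((1 + h) ω) - (1 - h)³ g((1 - h) ω))` (`dilationMean`), which `C₁ L_{C₂}` turns
into `(I - L_{C₀}) g`; the Neumann series telescopes to `g` (`hasSum_neumann_dilationMean`).

*Stability.* At `ω`, `(I - L_{C₀})⁻¹ C₁ L_{C₂} V` is a sum of values of `V` at frequencies of
modulus at most `|ω|`, with non-negative coefficients whose sum is at most `1` for every `η`. By
Cauchy–Schwarz the mean square error on `Ω` is therefore at most the length of `Ω` times the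
supremum, over the frequencies of modulus at most `sup |Ω|`, of the mean square of the `residual`,
the difference between `dilationMean` and `3 G(ω) + ω G'(ω)`.

*The residual* (`NoisyDilationModel.lintegral_residual_sq_le`) has three parts.
* The smoothing bias is `O(L²)`: the filter has mean `0` and variance `L²`, and the derivatives of
  `g` are bounded (`abs_smoothedSignal_sub_signalTerm_le`).
* The smoothed dilated spectra differ from the undilated one by `O(|τ|) = O(η)`, so that the average
  of `M` independent ones has variance `O(η² / M)` (`lintegral_signal_average_sq_le`).
* At each frequency the noise `|F + z|² - |F|² - σ²`, with `F` independent of the Gaussian `z`, is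
  centred with variance `O(σ² ∨ σ⁴)` (`noise_moments`), and averaging over the observations divides
  this by `M`. The noise need not be differentiable, so the derivative in `3 G + ω G'` falls on the
  filter; the resulting kernel has `L¹` norm `O(1 / L)` (`integral_abs_kern_le`), whence
  `O((σ² ∨ σ⁴) / (L² M))`.

That the estimator is almost surely well defined comes from the noise being almost surely integrable
against a Gaussian weight (`ae_integrable_mul_weight`).
-/

noncomputable section

namespace DilationMRA

/-! ### The Gaussian filter -/

/-- The probability measure on `ℝ` with density `gaussianFilter L`. -/
def filterMeasure (L : ℝ) : Measure ℝ := gaussianReal 0 (L ^ 2).toNNReal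

instance (L : ℝ) : IsProbabilityMeasure (filterMeasure L) := by
  unfold filterMeasure; infer_instance

/-- The derivative of the Gaussian filter. -/
def filterDeriv (L y : ℝ) : ℝ := -(y / L ^ 2) * gaussianFilter L y

/-- The kernel of the operator `D ↦ 3 (D * φ_L) + ω (D * φ_L)'` at the frequency `ω`. -/
def kern (L ω x : ℝ) : ℝ := 3 * gaussianFilter L (ω - x) + ω * filterDeriv L (ω - x)

/-- A Gaussian weight that dominates, locally uniformly in `ω`, both `x ↦ φ_L(ω - x)` and
`x ↦ φ_L'(ω - x)`. -/
def weight (L x : ℝ) : ℝ := Real.exp (-(x ^ 2 / (8 * L ^ 2)))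

lemma gaussianFilter_eq (L : ℝ) : gaussianFilter L = gaussianPDFReal 0 (L ^ 2).toNNReal := by
  funext x
  simp [gaussianFilter, gaussianPDFReal_def, Real.coe_toNNReal _ (sq_nonneg L), neg_div]

lemma gaussianFilter_nonneg (L y : ℝ) : 0 ≤ gaussianFilter L y := by
  rw [gaussianFilter_eq]; exact gaussianPDFReal_nonneg _ _ _

@[fun_prop]
lemma continuous_gaussianFilter (L : ℝ) : Continuous (gaussianFilter L) := by
  unfold gaussianFilter; fun_prop

@[fun_prop]
lemma continuous_filterDeriv (L : ℝ) : Continuous (filterDeriv L) := by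
  unfold filterDeriv; fun_prop

lemma continuous_uncurry_kern (L : ℝ) : Continuous (Function.uncurry (kern L)) := by
  unfold kern Function.uncurry; fun_prop

@[fun_prop]
lemma continuous_kern (L ω : ℝ) : Continuous (kern L ω) := by
  unfold kern; fun_prop

@[fun_prop]
lemma continuous_weight (L : ℝ) : Continuous (weight L) := by
  unfold weight; fun_prop

lemma weight_pos (L x : ℝ) : 0 < weight L x := Real.exp_pos _

lemma hasDerivAt_gaussianFilter (L y : ℝ) :
    HasDerivAt (gaussianFilter L) (filterDeriv L y) y := by
  have h : HasDerivAt (fun y => -(y ^ 2 / (2 * L ^ 2))) (-(2 * y / (2 * L ^ 2))) y := by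
    have := ((hasDerivAt_pow 2 y).div_const (2 * L ^ 2)).fun_neg
    simpa using this
  refine (h.exp.const_mul (√(2 * Real.pi * L ^ 2))⁻¹).congr_deriv ?_
  simp only [filterDeriv, gaussianFilter]
  field_simp

lemma toNNReal_sq_ne_zero {L : ℝ} (hL : 0 < L) : (L ^ 2).toNNReal ≠ 0 := by
  simp [Real.toNNReal_eq_zero, hL.ne']

lemma integral_filterMeasure {L : ℝ} (hL : 0 < L) (v : ℝ → ℝ) :
    ∫ y, v y ∂filterMeasure L = ∫ y, v y * gaussianFilter L y := by
  rw [filterMeasure, integral_gaussianReal_eq_integral_smul (toNNReal_sq_ne_zero hL),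
    gaussianFilter_eq]
  simp [mul_comm]

lemma integrable_filterMeasure_iff {L : ℝ} (hL : 0 < L) (v : ℝ → ℝ) :
    Integrable v (filterMeasure L) ↔ Integrable (fun y => v y * gaussianFilter L y) := by
  rw [filterMeasure, gaussianReal_of_var_ne_zero _ (toNNReal_sq_ne_zero hL),
    integrable_withDensity_iff (measurable_gaussianPDF _ _)
      (Eventually.of_forall fun x => gaussianPDF_lt_top), gaussianFilter_eq]
  simp [toReal_gaussianPDF]

lemma integrable_pow_filterMeasure (L : ℝ) (n : ℕ) :
    Integrable (fun y : ℝ => y ^ n) (filterMeasure L) := by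
  rcases Nat.eq_zero_or_pos n with rfl | hn
  · simp
  · have h := (memLp_id_gaussianReal' (μ := 0) (v := (L ^ 2).toNNReal) n
      (by simp)).integrable_norm_pow hn.ne'
    refine h.mono' (by fun_prop) (Eventually.of_forall fun y => ?_)
    simp

lemma integrable_id_filterMeasure (L : ℝ) : Integrable (fun y : ℝ => y) (filterMeasure L) := by
  simpa using integrable_pow_filterMeasure L 1

lemma integral_id_filterMeasure (L : ℝ) : ∫ y, y ∂filterMeasure L = 0 :=
  integral_id_gaussianReal

lemma integral_sq_filterMeasure (L : ℝ) : ∫ y, y ^ 2 ∂filterMeasure L = L ^ 2 := by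
  have h := variance_fun_id_gaussianReal (μ := 0) (v := (L ^ 2).toNNReal)
  rw [variance_of_integral_eq_zero (by fun_prop) integral_id_gaussianReal,
    Real.coe_toNNReal _ (sq_nonneg L)] at h
  exact h

lemma integral_abs_filterMeasure_le {L : ℝ} (hL : 0 < L) : ∫ y, |y| ∂filterMeasure L ≤ L := by
  have h : ∫ y, |y| ∂filterMeasure L ≤ ∫ y, (L / 2 + y ^ 2 / (2 * L)) ∂filterMeasure L := by
    refine integral_mono (integrable_id_filterMeasure L).abs
      ((integrable_const _).add ((integrable_pow_filterMeasure L 2).div_const _)) fun y => ?_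
    have : L / 2 + y ^ 2 / (2 * L) - |y| = (L - |y|) ^ 2 / (2 * L) := by
      field_simp
      rw [← sq_abs y]; ring
    have h2 : 0 ≤ (L - |y|) ^ 2 / (2 * L) := by positivity
    simp only
    linarith
  refine h.trans (le_of_eq ?_)
  rw [integral_add (integrable_const _) ((integrable_pow_filterMeasure L 2).div_const _),
    integral_div (2 * L) fun y : ℝ => y ^ 2, integral_sq_filterMeasure, integral_const]
  simp only [probReal_univ, smul_eq_mul]
  field_simp
  ring

lemma integrable_gaussianFilter (L : ℝ) : Integrable (gaussianFilter L) := by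
  rw [gaussianFilter_eq]; exact integrable_gaussianPDFReal _ _

lemma integral_gaussianFilter {L : ℝ} (hL : 0 < L) : ∫ y, gaussianFilter L y = 1 := by
  rw [gaussianFilter_eq]; exact integral_gaussianPDFReal_eq_one _ (toNNReal_sq_ne_zero hL)

lemma abs_filterDeriv (L y : ℝ) : |filterDeriv L y| = |y| * gaussianFilter L y / L ^ 2 := by
  rw [filterDeriv, abs_mul, abs_neg, abs_div, abs_of_nonneg (gaussianFilter_nonneg L y),
    abs_of_nonneg (sq_nonneg L)]
  ring

lemma integrable_filterDeriv {L : ℝ} (hL : 0 < L) : Integrable (filterDeriv L) := by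
  have h := ((integrable_filterMeasure_iff hL _).1 (integrable_id_filterMeasure L)).div_const
    (-L ^ 2)
  refine h.congr (Eventually.of_forall fun y => ?_)
  simp only [filterDeriv]
  field_simp

lemma integral_abs_filterDeriv_le {L : ℝ} (hL : 0 < L) : ∫ y, |filterDeriv L y| ≤ 1 / L := by
  simp_rw [abs_filterDeriv]
  rw [integral_div, ← integral_filterMeasure hL]
  refine (div_le_div_of_nonneg_right (integral_abs_filterMeasure_le hL) (by positivity)).trans
    (le_of_eq ?_)
  field_simp

lemma integrable_kern {L : ℝ} (hL : 0 < L) (ω : ℝ) : Integrable (kern L ω) :=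
  (((integrable_gaussianFilter L).comp_sub_left ω).const_mul 3).add
    (((integrable_filterDeriv hL).comp_sub_left ω).const_mul ω)

lemma integral_abs_kern_le {L : ℝ} (hL : 0 < L) (ω : ℝ) :
    ∫ x, |kern L ω x| ≤ 3 + |ω| / L := by
  have h1 := ((integrable_gaussianFilter L).comp_sub_left ω).const_mul 3
  have h2 := ((integrable_filterDeriv hL).comp_sub_left ω).abs.const_mul |ω|
  have h : ∫ x, |kern L ω x| ≤
      ∫ x, (3 * gaussianFilter L (ω - x) + |ω| * |filterDeriv L (ω - x)|) := by
    refine integral_mono (integrable_kern hL ω).abs (h1.add h2) fun x => ?_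
    refine (abs_add_le _ _).trans (le_of_eq ?_)
    rw [abs_mul, abs_mul, abs_of_nonneg (gaussianFilter_nonneg _ _)]
    norm_num
  refine h.trans ?_
  rw [integral_add h1 h2, integral_const_mul, integral_const_mul,
    integral_sub_left_eq_self (gaussianFilter L),
    integral_sub_left_eq_self (fun y => |filterDeriv L y|), integral_gaussianFilter hL]
  have := mul_le_mul_of_nonneg_left (integral_abs_filterDeriv_le hL) (abs_nonneg ω)
  rw [mul_one_div] at this
  linarith

/-- Second order Taylor expansion: as the filter has mean `0` and variance `L²`, smoothing changes
a function with bounded second derivative by `O(L²)`. -/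
lemma abs_integral_comp_sub_sub_le {L : ℝ} {v v₁ v₂ : ℝ → ℝ} {A B : ℝ}
    (h1 : ∀ x, HasDerivAt v (v₁ x) x) (h2 : ∀ x, HasDerivAt v₁ (v₂ x) x)
    (hA : ∀ x, |v x| ≤ A) (hB : ∀ x, |v₂ x| ≤ B) (ω : ℝ) :
    |∫ y, v (ω - y) ∂filterMeasure L - v ω| ≤ B * L ^ 2 := by
  have hc : Continuous v := continuous_iff_continuousAt.2 fun x => (h1 x).continuousAt
  have hi : Integrable (fun y => v (ω - y)) (filterMeasure L) :=
    Integrable.of_bound (by fun_prop) A (Eventually.of_forall fun y => hA _)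
  have htay : ∀ y, |v (ω - y) - v ω + y * v₁ ω| ≤ B * y ^ 2 := by
    intro y
    have hlip : ∀ z, |v₁ (ω - z) - v₁ ω| ≤ B * |z| := by
      intro z
      have := Convex.norm_image_sub_le_of_norm_hasDerivWithin_le (s := Set.univ) (f := v₁)
        (f' := v₂) (C := B) (fun x _ => (h2 x).hasDerivWithinAt) (fun x _ => hB x) convex_univ
        (Set.mem_univ ω) (Set.mem_univ (ω - z))
      simpa using this
    have hB0 : 0 ≤ B := (abs_nonneg _).trans (hB 0)
    have hd : ∀ z, HasDerivAt (fun z => v (ω - z) + z * v₁ ω) (-v₁ (ω - z) + v₁ ω) z := by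
      intro z
      have h3 : HasDerivAt (fun z => v (ω - z)) (-v₁ (ω - z)) z := by
        simpa using (h1 (ω - z)).comp_const_sub ω z
      simpa using h3.fun_add ((hasDerivAt_id' z).mul_const (v₁ ω))
    have := Convex.norm_image_sub_le_of_norm_hasDerivWithin_le (s := Set.uIcc 0 y)
      (f := fun z => v (ω - z) + z * v₁ ω) (f' := fun z => -v₁ (ω - z) + v₁ ω) (C := B * |y|)
      (fun x _ => (hd x).hasDerivWithinAt) (fun x hx => by
        have e : -v₁ (ω - x) + v₁ ω = -(v₁ (ω - x) - v₁ ω) := by ring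
        rw [e, norm_neg, Real.norm_eq_abs]
        refine (hlip x).trans (mul_le_mul_of_nonneg_left ?_ hB0)
        simpa using Set.abs_sub_left_of_mem_uIcc hx) (convex_uIcc 0 y)
        Set.left_mem_uIcc Set.right_mem_uIcc
    simp only [Real.norm_eq_abs, sub_zero, zero_mul, add_zero] at this
    have e : v (ω - y) + y * v₁ ω - v ω = v (ω - y) - v ω + y * v₁ ω := by ring
    rw [e, mul_assoc, ← pow_two, sq_abs] at this
    exact this
  have e : ∫ y, v (ω - y) ∂filterMeasure L - v ω =
      ∫ y, (v (ω - y) - v ω + y * v₁ ω) ∂filterMeasure L := by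
    have hi2 : Integrable (fun y => v (ω - y) - v ω) (filterMeasure L) :=
      hi.sub (integrable_const _)
    rw [integral_add hi2 ((integrable_id_filterMeasure L).mul_const _),
      integral_sub hi (integrable_const _), integral_mul_const, integral_id_filterMeasure]
    simp
  rw [e, ← integral_sq_filterMeasure, ← integral_const_mul]
  exact norm_integral_le_of_norm_le (f := fun y => v (ω - y) - v ω + y * v₁ ω)
    ((integrable_pow_filterMeasure L 2).const_mul B) (Eventually.of_forall htay)

/-! ### Smoothing a function of Gaussian-weighted integrability -/

/-- The constant by which `weight L` dominates the filter and its derivative on `|ω| ≤ R`. -/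
def domConst (L R : ℝ) : ℝ := (√(2 * Real.pi * L ^ 2))⁻¹ * Real.exp (R ^ 2 / (2 * L ^ 2))

lemma gaussianFilter_sub_le {L : ℝ} (hL : 0 < L) {R ω : ℝ} (h : |ω| ≤ R) (x : ℝ) :
    gaussianFilter L (ω - x) ≤ domConst L R * weight L x := by
  rw [gaussianFilter, domConst, weight, mul_assoc _ (Real.exp _), ← Real.exp_add]
  gcongr
  have hR : ω ^ 2 ≤ R ^ 2 := sq_le_sq' (abs_le.1 h).1 (abs_le.1 h).2
  have : R ^ 2 / (2 * L ^ 2) + -(x ^ 2 / (8 * L ^ 2)) - -((ω - x) ^ 2 / (2 * L ^ 2))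
      = (R ^ 2 - x ^ 2 / 4 + (ω - x) ^ 2) / (2 * L ^ 2) := by
    field_simp; ring
  have h2 : 0 ≤ (R ^ 2 - x ^ 2 / 4 + (ω - x) ^ 2) / (2 * L ^ 2) := by
    apply div_nonneg _ (by positivity)
    nlinarith [sq_nonneg (x - 2 * ω), sq_nonneg x]
  linarith

lemma abs_filterDeriv_sub_le {L : ℝ} (hL : 0 < L) {R ω : ℝ} (h : |ω| ≤ R) (x : ℝ) :
    |filterDeriv L (ω - x)| ≤ domConst L R / L * weight L x := by
  have hR : ω ^ 2 ≤ R ^ 2 := sq_le_sq' (abs_le.1 h).1 (abs_le.1 h).2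
  set y := ω - x with hy
  -- `z ≤ 1 + z² / 4 ≤ exp (z² / 4)` with `z = |y| / L`
  have h1 : |y| ≤ L * Real.exp (y ^ 2 / (4 * L ^ 2)) := by
    have h2 := Real.add_one_le_exp (y ^ 2 / (4 * L ^ 2))
    have h3 : L * (y ^ 2 / (4 * L ^ 2) + 1) - |y| = (|y| - 2 * L) ^ 2 / (4 * L) := by
      field_simp
      rw [← sq_abs y]; ring
    have h4 : 0 ≤ (|y| - 2 * L) ^ 2 / (4 * L) := by positivity
    have h5 := mul_le_mul_of_nonneg_left h2 hL.le
    linarith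
  rw [abs_filterDeriv, gaussianFilter, domConst, weight]
  have h5 : Real.exp (y ^ 2 / (4 * L ^ 2)) * Real.exp (-(y ^ 2 / (2 * L ^ 2))) ≤
      Real.exp (R ^ 2 / (2 * L ^ 2)) * Real.exp (-(x ^ 2 / (8 * L ^ 2))) := by
    rw [← Real.exp_add, ← Real.exp_add]
    refine Real.exp_le_exp.2 ?_
    have : R ^ 2 / (2 * L ^ 2) + -(x ^ 2 / (8 * L ^ 2)) -
        (y ^ 2 / (4 * L ^ 2) + -(y ^ 2 / (2 * L ^ 2)))
        = (4 * R ^ 2 - x ^ 2 + 2 * y ^ 2) / (8 * L ^ 2) := by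
      field_simp; ring
    have h2 : 0 ≤ (4 * R ^ 2 - x ^ 2 + 2 * y ^ 2) / (8 * L ^ 2) := by
      apply div_nonneg _ (by positivity)
      rw [hy]
      nlinarith [sq_nonneg (x - 2 * ω)]
    linarith
  set s := (√(2 * Real.pi * L ^ 2))⁻¹ with hs
  have hs0 : 0 ≤ s := by positivity
  calc |y| * (s * Real.exp (-(y ^ 2 / (2 * L ^ 2)))) / L ^ 2
      ≤ (L * Real.exp (y ^ 2 / (4 * L ^ 2))) * (s * Real.exp (-(y ^ 2 / (2 * L ^ 2)))) / L ^ 2 := by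
        gcongr
    _ = s / L * (Real.exp (y ^ 2 / (4 * L ^ 2)) * Real.exp (-(y ^ 2 / (2 * L ^ 2)))) := by
        field_simp
    _ ≤ s / L * (Real.exp (R ^ 2 / (2 * L ^ 2)) * Real.exp (-(x ^ 2 / (8 * L ^ 2)))) := by
        gcongr
    _ = _ := by ring

lemma integrable_weight {L : ℝ} (hL : 0 < L) : Integrable (weight L) := by
  have h := integrable_exp_neg_mul_sq (b := 1 / (8 * L ^ 2)) (by positivity)
  refine h.congr (Eventually.of_forall fun x => ?_)
  simp only [weight]
  congr 1
  ring

section Smoothing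

variable {L : ℝ} {D : ℝ → ℝ}

lemma integrable_mul_filterDeriv (hL : 0 < L) (hm : AEStronglyMeasurable D)
    (hD : Integrable fun x => D x * weight L x) (ω : ℝ) :
    Integrable fun x => D x * filterDeriv L (ω - x) := by
  refine (hD.norm.const_mul (domConst L |ω| / L)).mono' (hm.mul (by fun_prop))
    (Eventually.of_forall fun x => ?_)
  rw [norm_mul, norm_mul, Real.norm_eq_abs (filterDeriv _ _), Real.norm_eq_abs (weight _ _),
    abs_of_pos (weight_pos L x)]
  nlinarith [mul_le_mul_of_nonneg_left (abs_filterDeriv_sub_le hL le_rfl x (ω := ω))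
    (norm_nonneg (D x))]

lemma integrable_mul_gaussianFilter (hL : 0 < L) (hm : AEStronglyMeasurable D)
    (hD : Integrable fun x => D x * weight L x) (ω : ℝ) :
    Integrable fun x => D x * gaussianFilter L (ω - x) := by
  refine (hD.norm.const_mul (domConst L |ω|)).mono' (hm.mul (by fun_prop))
    (Eventually.of_forall fun x => ?_)
  rw [norm_mul, norm_mul, Real.norm_eq_abs (gaussianFilter _ _), Real.norm_eq_abs (weight _ _),
    abs_of_pos (weight_pos L x), abs_of_nonneg (gaussianFilter_nonneg _ _)]
  nlinarith [mul_le_mul_of_nonneg_left (gaussianFilter_sub_le hL le_rfl x (ω := ω))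
    (norm_nonneg (D x))]

lemma integrable_mul_kern (hL : 0 < L) (hm : AEStronglyMeasurable D)
    (hD : Integrable fun x => D x * weight L x) (ω : ℝ) :
    Integrable fun x => D x * kern L ω x := by
  refine (((integrable_mul_gaussianFilter hL hm hD ω).const_mul 3).add
    ((integrable_mul_filterDeriv hL hm hD ω).const_mul ω)).congr (Eventually.of_forall fun x => ?_)
  simp only [Pi.add_apply, kern]
  ring

lemma convolutionExists_gaussianFilter (hL : 0 < L) (hm : AEStronglyMeasurable D)
    (hD : Integrable fun x => D x * weight L x) :
    ConvolutionExists D (gaussianFilter L) (ContinuousLinearMap.mul ℝ ℝ) volume := fun ω => by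
  simpa [ConvolutionExistsAt] using integrable_mul_gaussianFilter hL hm hD ω

/-- The derivative falls on the filter: `(D * φ_L)' = D * φ_L'`. -/
lemma hasDerivAt_convolution_gaussianFilter (hL : 0 < L) (hm : AEStronglyMeasurable D)
    (hD : Integrable fun x => D x * weight L x) (ω : ℝ) :
    HasDerivAt (convolution D (gaussianFilter L) (ContinuousLinearMap.mul ℝ ℝ) volume)
      (∫ x, D x * filterDeriv L (ω - x)) ω := by
  have h := hasDerivAt_integral_of_dominated_loc_of_deriv_le (μ := volume)
    (F := fun ω x => D x * gaussianFilter L (ω - x))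
    (F' := fun ω x => D x * filterDeriv L (ω - x)) (x₀ := ω) (s := Metric.ball ω 1)
    (bound := fun x => domConst L (|ω| + 1) / L * ‖D x * weight L x‖)
    (Metric.ball_mem_nhds _ one_pos)
    (Eventually.of_forall fun ω' => hm.mul (by fun_prop))
    (integrable_mul_gaussianFilter hL hm hD ω) (hm.mul (by fun_prop))
    (Eventually.of_forall fun x ω' hω' => by
      have hb : |ω'| ≤ |ω| + 1 := by
        have h1 : |ω' - ω| < 1 := by simpa [Real.dist_eq] using hω'
        have h2 := abs_sub_abs_le_abs_sub ω' ω
        linarith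
      rw [norm_mul, norm_mul, Real.norm_eq_abs (filterDeriv _ _), Real.norm_eq_abs (weight _ _),
        abs_of_pos (weight_pos L x)]
      nlinarith [mul_le_mul_of_nonneg_left (abs_filterDeriv_sub_le hL hb x)
        (norm_nonneg (D x))])
    (hD.norm.const_mul _)
    (Eventually.of_forall fun x ω' _ => by
      have h3 : HasDerivAt (fun ω' => gaussianFilter L (ω' - x)) (filterDeriv L (ω' - x)) ω' := by
        exact (hasDerivAt_gaussianFilter L (ω' - x)).comp_sub_const ω' x
      exact h3.const_mul (D x))
  exact h.2

/-- `3 (D * φ_L) + ω (D * φ_L)'` as an integral operator. -/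
lemma three_mul_convolution_add (hL : 0 < L) (hm : AEStronglyMeasurable D)
    (hD : Integrable fun x => D x * weight L x) (ω : ℝ) :
    3 * convolution D (gaussianFilter L) (ContinuousLinearMap.mul ℝ ℝ) volume ω +
      ω * deriv (convolution D (gaussianFilter L) (ContinuousLinearMap.mul ℝ ℝ) volume) ω =
    ∫ x, D x * kern L ω x := by
  rw [(hasDerivAt_convolution_gaussianFilter hL hm hD ω).deriv]
  have e : ∀ x, D x * kern L ω x =
      3 * (D x * gaussianFilter L (ω - x)) + ω * (D x * filterDeriv L (ω - x)) := fun x => by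
    rw [kern]; ring
  simp_rw [e]
  rw [integral_add ((integrable_mul_gaussianFilter hL hm hD ω).const_mul 3)
    ((integrable_mul_filterDeriv hL hm hD ω).const_mul ω), integral_const_mul, integral_const_mul]
  rfl

lemma abs_integral_mul_kern_le (hL : 0 < L)
    (hD : Integrable fun x => D x * weight L x) {R ω : ℝ} (h : |ω| ≤ R) :
    |∫ x, D x * kern L ω x| ≤
      (3 * domConst L R + R * (domConst L R / L)) * ∫ x, ‖D x * weight L x‖ := by
  rw [← integral_const_mul]
  refine norm_integral_le_of_norm_le (f := fun x => D x * kern L ω x) (hD.norm.const_mul _)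
    (Eventually.of_forall fun x => ?_)
  have hR : 0 ≤ R := (abs_nonneg ω).trans h
  have hk : |kern L ω x| ≤ (3 * domConst L R + R * (domConst L R / L)) * weight L x := by
    refine (abs_add_le _ _).trans ?_
    rw [abs_mul, abs_mul, abs_of_nonneg (gaussianFilter_nonneg _ _)]
    have h1 := gaussianFilter_sub_le hL h x
    have h2 := mul_le_mul h (abs_filterDeriv_sub_le hL h x) (abs_nonneg _) hR
    norm_num
    linarith
  rw [norm_mul, norm_mul, Real.norm_eq_abs (kern _ _ _), Real.norm_eq_abs (weight _ _),
        abs_of_pos (weight_pos L x)]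
  nlinarith [mul_le_mul_of_nonneg_left hk (norm_nonneg (D x))]

end Smoothing

/-- For a bounded `u` with bounded derivative, the derivative can be moved from the filter back
to `u`. -/
lemma integral_mul_kern_eq {L : ℝ} (hL : 0 < L) {u u₁ : ℝ → ℝ} {A : ℝ}
    (h1 : ∀ x, HasDerivAt u (u₁ x) x) (hc : Continuous u₁) (hA : ∀ x, |u x| ≤ A)
    (hA₁ : ∀ x, |u₁ x| ≤ A) (ω : ℝ) :
    ∫ x, u x * kern L ω x = ∫ y, (3 * u (ω - y) + ω * u₁ (ω - y)) ∂filterMeasure L := by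
  have hcu : Continuous u := continuous_iff_continuousAt.2 fun x => (h1 x).continuousAt
  have i0 : Integrable fun x => u x * gaussianFilter L (ω - x) :=
    ((integrable_gaussianFilter L).comp_sub_left ω).bdd_mul hcu.aestronglyMeasurable
      (Eventually.of_forall hA)
  have i1 : Integrable fun x => u₁ x * gaussianFilter L (ω - x) :=
    ((integrable_gaussianFilter L).comp_sub_left ω).bdd_mul hc.aestronglyMeasurable
      (Eventually.of_forall hA₁)
  have i2 : Integrable fun x => u x * filterDeriv L (ω - x) :=
    ((integrable_filterDeriv hL).comp_sub_left ω).bdd_mul hcu.aestronglyMeasurable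
      (Eventually.of_forall hA)
  have hd : ∀ x, HasDerivAt (fun x => gaussianFilter L (ω - x)) (-filterDeriv L (ω - x)) x := by
    intro x
    simpa using (hasDerivAt_gaussianFilter L (ω - x)).comp_const_sub ω x
  have hparts := integral_mul_deriv_eq_deriv_mul_of_integrable (u := u)
    (v := fun x => gaussianFilter L (ω - x)) (u' := u₁) (v' := fun x => -filterDeriv L (ω - x))
    (fun x _ => h1 x) (fun x _ => hd x)
    (by refine i2.neg.congr (Eventually.of_forall fun x => ?_); simp) i1 i0
  have hparts2 : ∫ x, u x * filterDeriv L (ω - x) = ∫ x, u₁ x * gaussianFilter L (ω - x) := by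
    simp only [mul_neg, integral_neg, neg_inj] at hparts
    exact hparts
  have e : ∀ x, u x * kern L ω x =
      3 * (u x * gaussianFilter L (ω - x)) + ω * (u x * filterDeriv L (ω - x)) := fun x => by
    rw [kern]; ring
  simp_rw [e]
  rw [integral_add (i0.const_mul 3) (i2.const_mul ω), integral_const_mul, integral_const_mul,
    hparts2, ← integral_const_mul, ← integral_const_mul,
    ← integral_add (i0.const_mul 3) (i1.const_mul ω), integral_filterMeasure hL,
    ← integral_sub_left_eq_self _ volume ω]
  refine integral_congr_ae (Eventually.of_forall fun x => ?_)
  simp only [sub_sub_cancel]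
  ring

/-! ### Cauchy–Schwarz -/

/-- Cauchy–Schwarz with a weight: `(∫ a b)² ≤ (∫ a) (∫ a b²)`. -/
lemma sq_lintegral_mul_le {α : Type*} [MeasurableSpace α] {μ : Measure α} {a b : α → ENNReal}
    (ha : Measurable a) (hb : AEMeasurable b μ) :
    (∫⁻ x, a x * b x ∂μ) ^ 2 ≤ (∫⁻ x, a x ∂μ) * ∫⁻ x, a x * b x ^ 2 ∂μ := by
  have h := ENNReal.lintegral_mul_le_Lp_mul_Lq μ (p := 2) (q := 2)
    ⟨by norm_num, by norm_num, by norm_num⟩ (f := fun x => a x ^ (1 / 2 : ℝ))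
    (g := fun x => a x ^ (1 / 2 : ℝ) * b x)
    (ha.pow_const _).aemeasurable ((ha.pow_const _).aemeasurable.mul hb)
  have e0 : ∀ x, a x ^ (1 / 2 : ℝ) * a x ^ (1 / 2 : ℝ) = a x := fun x => by
    rw [← ENNReal.rpow_add_of_nonneg _ _ (by norm_num) (by norm_num)]; norm_num
  have e1 : ∀ x, ((fun x => a x ^ (1 / 2 : ℝ)) * (fun x => a x ^ (1 / 2 : ℝ) * b x)) x
      = a x * b x := fun x => by
    simp only [Pi.mul_apply]
    rw [← mul_assoc, e0]
  have e2 : ∀ x, (a x ^ (1 / 2 : ℝ)) ^ (2 : ℝ) = a x := fun x => by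
    rw [← ENNReal.rpow_mul]; norm_num
  have e3 : ∀ x, (a x ^ (1 / 2 : ℝ) * b x) ^ (2 : ℝ) = a x * b x ^ 2 := fun x => by
    rw [ENNReal.mul_rpow_of_nonneg _ _ (by norm_num), e2]; norm_num
  simp_rw [e1, e2, e3] at h
  calc _ ≤ ((∫⁻ x, a x ∂μ) ^ (1 / 2 : ℝ) * (∫⁻ x, a x * b x ^ 2 ∂μ) ^ (1 / 2 : ℝ)) ^ 2 := by
        gcongr
    _ = _ := by
        rw [mul_pow, ← ENNReal.rpow_natCast, ← ENNReal.rpow_natCast, ← ENNReal.rpow_mul,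
          ← ENNReal.rpow_mul]
        norm_num

/-! ### Regularity of the power spectrum -/

/-- `g` has derivatives `g₁`, `g₂`, `g₃`, and all four functions are bounded by `K`. -/
structure HasBoundedDerivs (g g₁ g₂ g₃ : ℝ → ℝ) (K : ℝ) : Prop where
  d1 : ∀ x, HasDerivAt g (g₁ x) x
  d2 : ∀ x, HasDerivAt g₁ (g₂ x) x
  d3 : ∀ x, HasDerivAt g₂ (g₃ x) x
  b0 : ∀ x, |g x| ≤ K
  b1 : ∀ x, |g₁ x| ≤ K
  b2 : ∀ x, |g₂ x| ≤ K
  b3 : ∀ x, |g₃ x| ≤ K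

/-- `∫ xᵏ f(x) cos(xω) dx`. -/
def cosMoment (f : ℝ → ℝ) (k : ℕ) (ω : ℝ) : ℝ := ∫ x, x ^ k * f x * Real.cos (x * ω)

/-- `∫ xᵏ f(x) sin(xω) dx`. -/
def sinMoment (f : ℝ → ℝ) (k : ℕ) (ω : ℝ) : ℝ := ∫ x, x ^ k * f x * Real.sin (x * ω)

section Moments

variable {f : ℝ → ℝ}

lemma integrable_pow_mul (hf : MemLp f 2) (hfc : HasCompactSupport f) (k : ℕ) :
    Integrable fun x => x ^ k * f x := by
  have hli : LocallyIntegrable f := hf.locallyIntegrable (by norm_num)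
  have hint : IntegrableOn (fun x => x ^ k * f x) (tsupport f) :=
    (hli.integrableOn_isCompact hfc).continuousOn_mul (by fun_prop) hfc
  refine (integrableOn_iff_integrable_of_support_subset ?_).1 hint
  exact (Function.support_mul_subset_right _ _).trans (subset_tsupport f)

lemma integrable_of_memLp_two (hf : MemLp f 2) (hfc : HasCompactSupport f) : Integrable f := by
  simpa using integrable_pow_mul hf hfc 0

lemma hasDerivAt_cosMoment (hf : MemLp f 2) (hfc : HasCompactSupport f) (k : ℕ) (ω : ℝ) :
    HasDerivAt (cosMoment f k) (-sinMoment f (k + 1) ω) ω := by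
  have h := hasDerivAt_integral_of_dominated_loc_of_deriv_le (μ := volume)
    (F := fun ω x => x ^ k * f x * Real.cos (x * ω))
    (F' := fun ω x => -(x ^ (k + 1) * f x * Real.sin (x * ω))) (x₀ := ω) (s := Set.univ)
    (bound := fun x => ‖x ^ (k + 1) * f x‖) univ_mem
    (Eventually.of_forall fun ω' =>
      (integrable_pow_mul hf hfc k).aestronglyMeasurable.mul (by fun_prop))
    ((integrable_pow_mul hf hfc k).mul_bdd (c := 1) (by fun_prop)
      (Eventually.of_forall fun x => by simpa using Real.abs_cos_le_one _))
    (((integrable_pow_mul hf hfc (k + 1)).aestronglyMeasurable.mul (by fun_prop)).neg)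
    (Eventually.of_forall fun x ω' _ => by
      rw [norm_neg, norm_mul]
      exact mul_le_of_le_one_right (norm_nonneg _) (by simpa using Real.abs_sin_le_one _))
    (integrable_pow_mul hf hfc (k + 1)).norm
    (Eventually.of_forall fun x ω' _ => by
      have h1 : HasDerivAt (fun ω => x * ω) x ω' := by
        simpa using (hasDerivAt_id' ω').const_mul x
      refine (h1.cos.const_mul (x ^ k * f x)).congr_deriv ?_
      ring)
  refine h.2.congr_deriv ?_
  rw [integral_neg, sinMoment]

lemma hasDerivAt_sinMoment (hf : MemLp f 2) (hfc : HasCompactSupport f) (k : ℕ) (ω : ℝ) :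
    HasDerivAt (sinMoment f k) (cosMoment f (k + 1) ω) ω := by
  have h := hasDerivAt_integral_of_dominated_loc_of_deriv_le (μ := volume)
    (F := fun ω x => x ^ k * f x * Real.sin (x * ω))
    (F' := fun ω x => x ^ (k + 1) * f x * Real.cos (x * ω)) (x₀ := ω) (s := Set.univ)
    (bound := fun x => ‖x ^ (k + 1) * f x‖) univ_mem
    (Eventually.of_forall fun ω' =>
      (integrable_pow_mul hf hfc k).aestronglyMeasurable.mul (by fun_prop))
    ((integrable_pow_mul hf hfc k).mul_bdd (c := 1) (by fun_prop)
      (Eventually.of_forall fun x => by simpa using Real.abs_sin_le_one _))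
    ((integrable_pow_mul hf hfc (k + 1)).aestronglyMeasurable.mul (by fun_prop))
    (Eventually.of_forall fun x ω' _ => by
      rw [norm_mul]
      exact mul_le_of_le_one_right (norm_nonneg _) (by simpa using Real.abs_cos_le_one _))
    (integrable_pow_mul hf hfc (k + 1)).norm
    (Eventually.of_forall fun x ω' _ => by
      have h1 : HasDerivAt (fun ω => x * ω) x ω' := by
        simpa using (hasDerivAt_id' ω').const_mul x
      refine (h1.sin.const_mul (x ^ k * f x)).congr_deriv ?_
      ring)
  exact h.2

lemma abs_cosMoment_le (hf : MemLp f 2) (hfc : HasCompactSupport f) (k : ℕ) (ω : ℝ) :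
    |cosMoment f k ω| ≤ ∫ x, |x ^ k * f x| :=
  norm_integral_le_of_norm_le (f := fun x => x ^ k * f x * Real.cos (x * ω))
    (integrable_pow_mul hf hfc k).norm (Eventually.of_forall fun x => by
      rw [norm_mul]
      exact mul_le_of_le_one_right (norm_nonneg _) (by simpa using Real.abs_cos_le_one _))

lemma abs_sinMoment_le (hf : MemLp f 2) (hfc : HasCompactSupport f) (k : ℕ) (ω : ℝ) :
    |sinMoment f k ω| ≤ ∫ x, |x ^ k * f x| :=
  norm_integral_le_of_norm_le (f := fun x => x ^ k * f x * Real.sin (x * ω))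
    (integrable_pow_mul hf hfc k).norm (Eventually.of_forall fun x => by
      rw [norm_mul]
      exact mul_le_of_le_one_right (norm_nonneg _) (by simpa using Real.abs_sin_le_one _))

lemma hat_eq_moments (hf : MemLp f 2) (hfc : HasCompactSupport f) (ω : ℝ) :
    hat f ω = (cosMoment f 0 ω : ℂ) - Complex.I * (sinMoment f 0 ω : ℂ) := by
  have hi := integrable_of_memLp_two hf hfc
  have ic : Integrable fun x => f x * Real.cos (x * ω) := hi.mul_bdd (c := 1) (by fun_prop)
      (Eventually.of_forall fun x => by simpa using Real.abs_cos_le_one _)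
  have is : Integrable fun x => f x * Real.sin (x * ω) := hi.mul_bdd (c := 1) (by fun_prop)
      (Eventually.of_forall fun x => by simpa using Real.abs_sin_le_one _)
  have e : ∀ x : ℝ, (f x : ℂ) * Complex.exp (-(Complex.I * (x : ℂ) * (ω : ℂ))) =
      ((f x * Real.cos (x * ω) : ℝ) : ℂ) - Complex.I * ((f x * Real.sin (x * ω) : ℝ) : ℂ) := by
    intro x
    have : -(Complex.I * (x : ℂ) * (ω : ℂ)) = ((-(x * ω) : ℝ) : ℂ) * Complex.I := by
      push_cast; ring
    rw [this, Complex.exp_mul_I, ← Complex.ofReal_cos, ← Complex.ofReal_sin, Real.cos_neg,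
      Real.sin_neg]
    push_cast
    ring
  simp only [hat, cosMoment, sinMoment, pow_zero, one_mul]
  simp_rw [e]
  rw [integral_sub ic.ofReal (is.ofReal.const_mul _), integral_const_mul,
    integral_complex_ofReal, integral_complex_ofReal]

lemma powerSpectrum_eq_moments (hf : MemLp f 2) (hfc : HasCompactSupport f) (ω : ℝ) :
    powerSpectrum f ω = cosMoment f 0 ω ^ 2 + sinMoment f 0 ω ^ 2 := by
  rw [powerSpectrum, hat_eq_moments hf hfc, ← Complex.normSq_eq_norm_sq, Complex.normSq_apply]
  simp
  ring

lemma continuous_hat (hf : MemLp f 2) (hfc : HasCompactSupport f) : Continuous (hat f) := by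
  have h1 : Continuous (cosMoment f 0) :=
    continuous_iff_continuousAt.2 fun x => (hasDerivAt_cosMoment hf hfc 0 x).continuousAt
  have h2 : Continuous (sinMoment f 0) :=
    continuous_iff_continuousAt.2 fun x => (hasDerivAt_sinMoment hf hfc 0 x).continuousAt
  have : hat f = fun ω => (cosMoment f 0 ω : ℂ) - Complex.I * (sinMoment f 0 ω : ℂ) :=
    funext (hat_eq_moments hf hfc)
  rw [this]
  fun_prop

lemma abs_mul_add_mul_le {a b c d A C : ℝ} (ha : |a| ≤ A) (hb : |b| ≤ A) (hc : |c| ≤ C)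
    (hd : |d| ≤ C) : |a * c + b * d| ≤ 2 * (A * C) := by
  refine (abs_add_le _ _).trans ?_
  rw [abs_mul, abs_mul]
  have hA := (abs_nonneg a).trans ha
  have h1 := mul_le_mul ha hc (abs_nonneg _) hA
  have h2 := mul_le_mul hb hd (abs_nonneg _) hA
  linarith

/-- As `f` is integrable with compact support, its power spectrum has bounded derivatives. -/
lemma exists_hasBoundedDerivs (hf : MemLp f 2) (hfc : HasCompactSupport f) :
    ∃ g₁ g₂ g₃ K, HasBoundedDerivs (powerSpectrum f) g₁ g₂ g₃ K := by
  set a := cosMoment f with ha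
  set b := sinMoment f with hb
  obtain ⟨m, hm⟩ : ∃ m : ℕ → ℝ, ∀ k ω, |a k ω| ≤ m k ∧ |b k ω| ≤ m k :=
    ⟨fun k => ∫ x, |x ^ k * f x|, fun k ω =>
      ⟨abs_cosMoment_le hf hfc k ω, abs_sinMoment_le hf hfc k ω⟩⟩
  have hm0 : ∀ k, 0 ≤ m k := fun k => (abs_nonneg _).trans (hm k 0).1
  have da : ∀ k ω, HasDerivAt (a k) (-b (k + 1) ω) ω := hasDerivAt_cosMoment hf hfc
  have db : ∀ k ω, HasDerivAt (b k) (a (k + 1) ω) ω := hasDerivAt_sinMoment hf hfc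
  have hg : powerSpectrum f = fun ω => a 0 ω * a 0 ω + b 0 ω * b 0 ω :=
    funext fun ω => by rw [powerSpectrum_eq_moments hf hfc]; ring
  rw [hg]
  have hba : ∀ i j ω, |a i ω * a j ω + b i ω * b j ω| ≤ 2 * (m i * m j) := fun i j ω =>
    abs_mul_add_mul_le (hm i ω).1 (hm i ω).2 (hm j ω).1 (hm j ω).2
  have hbb : ∀ i j ω, |b i ω * a j ω + (-a i ω) * b j ω| ≤ 2 * (m i * m j) := fun i j ω =>
    abs_mul_add_mul_le (hm i ω).2 (by rw [abs_neg]; exact (hm i ω).1) (hm j ω).1 (hm j ω).2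
  refine ⟨fun ω => 2 * (b 0 ω * a 1 ω + (-a 0 ω) * b 1 ω),
    fun ω => 2 * (a 1 ω * a 1 ω + b 1 ω * b 1 ω) - 2 * (a 0 ω * a 2 ω + b 0 ω * b 2 ω),
    fun ω => 6 * (b 1 ω * a 2 ω + (-a 1 ω) * b 2 ω) - 2 * (b 0 ω * a 3 ω + (-a 0 ω) * b 3 ω),
    2 * (m 0 * m 0) + 4 * (m 0 * m 1) + (4 * (m 1 * m 1) + 4 * (m 0 * m 2))
      + (12 * (m 1 * m 2) + 4 * (m 0 * m 3)), ?_⟩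
  have p := fun i j => mul_nonneg (hm0 i) (hm0 j)
  have p00 := p 0 0
  have p01 := p 0 1
  have p11 := p 1 1
  have p02 := p 0 2
  have p12 := p 1 2
  have p03 := p 0 3
  constructor
  · intro ω
    exact (((da 0 ω).fun_mul (da 0 ω)).fun_add ((db 0 ω).fun_mul (db 0 ω))).congr_deriv (by
      simp only [zero_add]; ring)
  · intro ω
    exact ((((db 0 ω).fun_mul (da 1 ω)).fun_add ((da 0 ω).fun_neg.fun_mul (db 1 ω))).const_mul
      2).congr_deriv (by simp only [zero_add, Nat.reduceAdd]; ring)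
  · intro ω
    exact (((((da 1 ω).fun_mul (da 1 ω)).fun_add ((db 1 ω).fun_mul (db 1 ω))).const_mul 2).fun_sub
      ((((da 0 ω).fun_mul (da 2 ω)).fun_add ((db 0 ω).fun_mul (db 2 ω))).const_mul 2)).congr_deriv
      (by simp only [zero_add, Nat.reduceAdd]; ring)
  · intro ω
    have := hba 0 0 ω
    linarith
  · intro ω
    have := abs_le.1 (hbb 0 1 ω)
    exact abs_le.2 ⟨by linarith, by linarith⟩
  · intro ω
    have h1 := abs_le.1 (hba 1 1 ω)
    have h2 := abs_le.1 (hba 0 2 ω)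
    exact abs_le.2 ⟨by linarith, by linarith⟩
  · intro ω
    have h1 := abs_le.1 (hbb 1 2 ω)
    have h2 := abs_le.1 (hbb 0 3 ω)
    exact abs_le.2 ⟨by linarith, by linarith⟩

/-- The Fourier transform of a translated and dilated signal. -/
lemma hat_dilatedSignal (f : ℝ → ℝ) {τ : ℝ} (hτ : τ < 1) (t ω : ℝ) :
    hat (dilatedSignal f τ t) ω = ((1 - τ : ℝ) : ℂ) *
      (Complex.exp (-(Complex.I * (t : ℂ) * (ω : ℂ))) * hat f ((1 - τ) * ω)) := by
  have h0 : 0 < 1 - τ := by linarith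
  set H : ℝ → ℂ := fun z => Complex.exp (-(Complex.I * (t : ℂ) * (ω : ℂ))) *
    ((f z : ℂ) * Complex.exp (-(Complex.I * (z : ℂ) * (((1 - τ) * ω : ℝ) : ℂ)))) with hH
  have e : ∀ x : ℝ, (dilatedSignal f τ t x : ℂ) * Complex.exp (-(Complex.I * (x : ℂ) * (ω : ℂ))) =
      H ((1 - τ)⁻¹ * (x - t)) := by
    intro x
    simp only [hH, dilatedSignal]
    rw [mul_left_comm, ← Complex.exp_add]
    congr 2
    have : ((1 - τ : ℝ) : ℂ) ≠ 0 := by exact_mod_cast h0.ne'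
    push_cast at this ⊢
    field_simp
    ring
  rw [hat]
  simp_rw [e]
  rw [integral_sub_right_eq_self (fun x => H ((1 - τ)⁻¹ * x)) t, Measure.integral_comp_mul_left,
    inv_inv, abs_of_pos h0, hH, integral_const_mul, Complex.real_smul, hat]

end Moments

/-! ### The signal part of the data term -/

/-- `3 u(x) + ω u'(x)` for the power spectrum `u(x) = (1 - τ)² g((1 - τ) x)` of a dilated signal,
where `g₁ = g'`. -/
def signalTerm (g g₁ : ℝ → ℝ) (τ ω x : ℝ) : ℝ :=
  3 * ((1 - τ) ^ 2 * g ((1 - τ) * x)) + ω * ((1 - τ) ^ 3 * g₁ ((1 - τ) * x))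

/-- The contribution `3 (u * φ_L)(ω) + ω (u * φ_L)'(ω)` of one dilated signal, dilated by
`1 - τ`. -/
def smoothedSignal (g g₁ : ℝ → ℝ) (L τ ω : ℝ) : ℝ :=
  ∫ y, signalTerm g g₁ τ ω (ω - y) ∂filterMeasure L

/-- The mean of `τ ↦ signalTerm g g' τ ω ω` when `τ` is uniform on `[-h, h]`. -/
def dilationMean (g : ℝ → ℝ) (h ω : ℝ) : ℝ :=
  (2 * h)⁻¹ * ((1 + h) ^ 3 * g ((1 + h) * ω) - (1 - h) ^ 3 * g ((1 - h) * ω))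

section Signal

variable {g g₁ g₂ g₃ : ℝ → ℝ} {K : ℝ}

lemma abs_signalTerm_le (h0 : ∀ x, |g x| ≤ K) (h1 : ∀ x, |g₁ x| ≤ K) {τ : ℝ}
    (hτ : |τ| ≤ 1 / 2) (ω x : ℝ) : |signalTerm g g₁ τ ω x| ≤ 4 * K * (3 + |ω|) := by
  have hK : 0 ≤ K := (abs_nonneg _).trans (h0 0)
  obtain ⟨hl, hr⟩ := abs_le.1 hτ
  have p2 : (1 - τ) ^ 2 ≤ 4 := by nlinarith
  have p3 : (1 - τ) ^ 3 ≤ 4 := by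
    have := pow_le_pow_left₀ (by linarith) (by linarith : 1 - τ ≤ 3 / 2) 3
    norm_num at this
    linarith
  have n3 : 0 ≤ (1 - τ) ^ 3 := pow_nonneg (by linarith) 3
  refine (abs_add_le _ _).trans ?_
  rw [abs_mul, abs_mul, abs_mul, abs_mul, abs_of_nonneg (sq_nonneg (1 - τ)), abs_of_nonneg n3,
    abs_of_pos (three_pos : (0 : ℝ) < 3)]
  have i1 := mul_le_mul p2 (h0 ((1 - τ) * x)) (abs_nonneg _) (by norm_num)
  have i2 := mul_le_mul_of_nonneg_left (mul_le_mul p3 (h1 ((1 - τ) * x)) (abs_nonneg _)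
    (by norm_num)) (abs_nonneg ω)
  linarith

lemma hasDerivAt_signalTerm (h1 : ∀ x, HasDerivAt g (g₁ x) x) (h2 : ∀ x, HasDerivAt g₁ (g₂ x) x)
    (τ ω x : ℝ) : HasDerivAt (signalTerm g g₁ τ ω) ((1 - τ) * signalTerm g₁ g₂ τ ω x) x := by
  have h : HasDerivAt (fun x : ℝ => (1 - τ) * x) (1 - τ) x := by
    simpa using (hasDerivAt_id' x).const_mul (1 - τ)
  have h3 : HasDerivAt (fun x : ℝ => g ((1 - τ) * x)) (g₁ ((1 - τ) * x) * (1 - τ)) x :=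
    (h1 _).comp x h
  have h4 : HasDerivAt (fun x : ℝ => g₁ ((1 - τ) * x)) (g₂ ((1 - τ) * x) * (1 - τ)) x :=
    (h2 _).comp x h
  refine (((h3.const_mul ((1 - τ) ^ 2)).const_mul 3).fun_add
    ((h4.const_mul ((1 - τ) ^ 3)).const_mul ω)).congr_deriv ?_
  rw [signalTerm]
  ring

namespace HasBoundedDerivs

lemma nonneg (hg : HasBoundedDerivs g g₁ g₂ g₃ K) : 0 ≤ K := (abs_nonneg _).trans (hg.b0 0)

lemma continuous (hg : HasBoundedDerivs g g₁ g₂ g₃ K) : Continuous g :=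
  continuous_iff_continuousAt.2 fun x => (hg.d1 x).continuousAt

lemma continuous₁ (hg : HasBoundedDerivs g g₁ g₂ g₃ K) : Continuous g₁ :=
  continuous_iff_continuousAt.2 fun x => (hg.d2 x).continuousAt

lemma continuous_signalTerm (hg : HasBoundedDerivs g g₁ g₂ g₃ K) :
    Continuous fun p : ℝ × ℝ × ℝ => signalTerm g g₁ p.1 p.2.1 p.2.2 := by
  have := hg.continuous
  have := hg.continuous₁
  unfold signalTerm
  fun_prop

lemma dilationMean_eq (hg : HasBoundedDerivs g g₁ g₂ g₃ K) (h ω : ℝ) :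
    dilationMean g h ω = (2 * h)⁻¹ * ∫ τ in (-h)..h, signalTerm g g₁ τ ω ω := by
  have hd : ∀ τ ∈ Set.uIcc (-h) h, HasDerivAt (fun τ => -((1 - τ) ^ 3 * g ((1 - τ) * ω)))
      (signalTerm g g₁ τ ω ω) τ := fun τ _ => by
    have h1 : HasDerivAt (fun τ : ℝ => 1 - τ) (-1) τ := by
      simpa using (hasDerivAt_id' τ).const_sub 1
    have h2 : HasDerivAt (fun τ : ℝ => (1 - τ) ^ 3) (3 * (1 - τ) ^ 2 * (-1)) τ := by
      simpa using h1.fun_pow 3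
    have h3 : HasDerivAt (fun τ : ℝ => g ((1 - τ) * ω)) (g₁ ((1 - τ) * ω) * (-1 * ω)) τ :=
      (hg.d1 _).comp τ (h1.mul_const ω)
    refine (h2.fun_mul h3).fun_neg.congr_deriv ?_
    rw [signalTerm]
    ring
  have hc := hg.continuous_signalTerm
  have hcτ : Continuous fun τ => signalTerm g g₁ τ ω ω :=
    hc.comp (f := fun τ : ℝ => (τ, ω, ω)) (by fun_prop)
  rw [intervalIntegral.integral_eq_sub_of_hasDerivAt hd (hcτ.intervalIntegrable _ _),
    dilationMean]
  ring_nf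

/-- The bias of the Gaussian smoothing is `O(L²)`. -/
lemma abs_smoothedSignal_sub_signalTerm_le (hg : HasBoundedDerivs g g₁ g₂ g₃ K) {τ : ℝ}
    (hτ : |τ| ≤ 1 / 2) (L ω : ℝ) :
    |smoothedSignal g g₁ L τ ω - signalTerm g g₁ τ ω ω| ≤ 9 * K * (3 + |ω|) * L ^ 2 :=
  abs_integral_comp_sub_sub_le (hasDerivAt_signalTerm hg.d1 hg.d2 τ ω)
    (fun x => (hasDerivAt_signalTerm hg.d2 hg.d3 τ ω x).const_mul (1 - τ))
    (abs_signalTerm_le hg.b0 hg.b1 hτ ω) (fun x => by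
      obtain ⟨hl, hr⟩ := abs_le.1 hτ
      have p2 : (1 - τ) ^ 2 ≤ 9 / 4 := by nlinarith
      have h := mul_le_mul p2 (abs_signalTerm_le hg.b2 hg.b3 hτ ω x) (abs_nonneg _) (by norm_num)
      rw [← mul_assoc, ← pow_two, abs_mul, abs_of_nonneg (sq_nonneg _)]
      linarith) ω

lemma abs_signalTerm_sub_le (hg : HasBoundedDerivs g g₁ g₂ g₃ K) {τ : ℝ} (hτ : |τ| ≤ 1 / 2)
    (ω x : ℝ) : |signalTerm g g₁ τ ω x - signalTerm g g₁ 0 ω x| ≤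
      5 * K * (3 + |ω|) * |τ| * (1 + |x|) := by
  have hK := hg.nonneg
  obtain ⟨hl, hr⟩ := abs_le.1 hτ
  have hlip : ∀ {v v₁ : ℝ → ℝ}, (∀ x, HasDerivAt v (v₁ x) x) → (∀ x, |v₁ x| ≤ K) →
      |v ((1 - τ) * x) - v x| ≤ K * (|τ| * |x|) := by
    intro v v₁ h1 h2
    have := Convex.norm_image_sub_le_of_norm_hasDerivWithin_le (s := Set.univ) (f := v)
      (f' := v₁) (C := K) (fun x _ => (h1 x).hasDerivWithinAt) (fun x _ => h2 x) convex_univ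
      (Set.mem_univ x) (Set.mem_univ ((1 - τ) * x))
    have e : (1 - τ) * x - x = -(τ * x) := by ring
    simpa [e, abs_mul] using this
  have p2 : |(1 - τ) ^ 2| ≤ 9 / 4 := by
    rw [abs_of_nonneg (sq_nonneg _)]; nlinarith
  have p3 : |(1 - τ) ^ 3| ≤ 4 := by
    rw [abs_of_nonneg (pow_nonneg (by linarith) 3)]
    have := pow_le_pow_left₀ (by linarith) (by linarith : 1 - τ ≤ 3 / 2) 3
    norm_num at this
    linarith
  have q2 : |(1 - τ) ^ 2 - 1| ≤ 5 * |τ| := by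
    have e : (1 - τ) ^ 2 - 1 = (τ - 2) * τ := by ring
    rw [e, abs_mul]
    exact mul_le_mul_of_nonneg_right (abs_le.2 ⟨by linarith, by linarith⟩) (abs_nonneg _)
  have q3 : |(1 - τ) ^ 3 - 1| ≤ 5 * |τ| := by
    have e : (1 - τ) ^ 3 - 1 = (-3 + 3 * τ - τ ^ 2) * τ := by ring
    rw [e, abs_mul]
    exact mul_le_mul_of_nonneg_right (abs_le.2 ⟨by nlinarith, by nlinarith⟩) (abs_nonneg _)
  have main : ∀ {v v₁ : ℝ → ℝ} {a : ℝ}, (∀ x, HasDerivAt v (v₁ x) x) → (∀ x, |v x| ≤ K) →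
      (∀ x, |v₁ x| ≤ K) → |a| ≤ 4 → |a - 1| ≤ 5 * |τ| →
      |a * v ((1 - τ) * x) - v x| ≤ 5 * K * |τ| * (1 + |x|) := by
    intro v v₁ a h1 h2 h3 ha ha1
    have e : a * v ((1 - τ) * x) - v x = a * (v ((1 - τ) * x) - v x) + (a - 1) * v x := by ring
    rw [e]
    refine (abs_add_le _ _).trans ?_
    rw [abs_mul, abs_mul]
    have i1 := mul_le_mul ha (hlip h1 h3) (abs_nonneg _) (by norm_num)
    have i2 := mul_le_mul ha1 (h2 x) (abs_nonneg _) (by positivity)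
    have i3 : 0 ≤ K * (|τ| * |x|) := by positivity
    linarith
  have m1 := main hg.d1 hg.b0 hg.b1 (p2.trans (by norm_num)) q2
  have m2 := main hg.d2 hg.b1 hg.b2 p3 q3
  have e : signalTerm g g₁ τ ω x - signalTerm g g₁ 0 ω x =
      3 * ((1 - τ) ^ 2 * g ((1 - τ) * x) - g x) +
        ω * ((1 - τ) ^ 3 * g₁ ((1 - τ) * x) - g₁ x) := by
    simp only [signalTerm, sub_zero, one_pow, one_mul]
    ring
  rw [e]
  refine (abs_add_le _ _).trans ?_
  rw [abs_mul, abs_mul, abs_of_pos (three_pos : (0 : ℝ) < 3)]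
  have := mul_le_mul_of_nonneg_left m2 (abs_nonneg ω)
  linarith

lemma integrable_signalTerm (hg : HasBoundedDerivs g g₁ g₂ g₃ K) {τ : ℝ} (hτ : |τ| ≤ 1 / 2)
    (L ω : ℝ) : Integrable (fun y => signalTerm g g₁ τ ω (ω - y)) (filterMeasure L) := by
  have hc : Continuous fun y => signalTerm g g₁ τ ω (ω - y) :=
    hg.continuous_signalTerm.comp (f := fun y : ℝ => (τ, ω, ω - y)) (by fun_prop)
  exact Integrable.of_bound hc.aestronglyMeasurable _
    (Eventually.of_forall fun y => abs_signalTerm_le hg.b0 hg.b1 hτ ω _)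

lemma abs_smoothedSignal_le (hg : HasBoundedDerivs g g₁ g₂ g₃ K) {τ : ℝ}
    (hτ : |τ| ≤ 1 / 2) (L ω : ℝ) : |smoothedSignal g g₁ L τ ω| ≤ 4 * K * (3 + |ω|) := by
  have := norm_integral_le_of_norm_le_const (μ := filterMeasure L)
    (f := fun y => signalTerm g g₁ τ ω (ω - y)) (C := 4 * K * (3 + |ω|))
    (Eventually.of_forall fun y => abs_signalTerm_le hg.b0 hg.b1 hτ ω (ω - y))
  simpa [smoothedSignal] using this

/-- A dilation by `1 - τ` changes the smoothed data term by `O(|τ|)`. -/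
lemma abs_smoothedSignal_sub_le (hg : HasBoundedDerivs g g₁ g₂ g₃ K) {τ : ℝ}
    (hτ : |τ| ≤ 1 / 2) {L : ℝ} (hL : 0 < L) (ω : ℝ) :
    |smoothedSignal g g₁ L τ ω - smoothedSignal g g₁ L 0 ω| ≤
      5 * K * (3 + |ω|) * (1 + |ω| + L) * |τ| := by
  have hK := hg.nonneg
  rw [smoothedSignal, smoothedSignal, ← integral_sub (hg.integrable_signalTerm hτ L ω)
    (hg.integrable_signalTerm (by norm_num) L ω)]
  have hi := (integrable_id_filterMeasure L).abs
  have hi2 : Integrable (fun y => (1 + |ω|) + |y|) (filterMeasure L) :=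
    (integrable_const _).add hi
  refine (norm_integral_le_of_norm_le
    (f := fun y => signalTerm g g₁ τ ω (ω - y) - signalTerm g g₁ 0 ω (ω - y))
    (g := fun y => 5 * K * (3 + |ω|) * |τ| * ((1 + |ω|) + |y|))
    (hi2.const_mul _) (Eventually.of_forall fun y => ?_)).trans ?_
  · refine (hg.abs_signalTerm_sub_le hτ ω _).trans ?_
    have := abs_sub ω y
    exact mul_le_mul_of_nonneg_left (by linarith) (by positivity)
  · rw [integral_const_mul, integral_add (integrable_const _) hi]
    have := integral_abs_filterMeasure_le hL
    simp only [integral_const, probReal_univ, one_smul]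
    have h2 : 0 ≤ 5 * K * (3 + |ω|) * |τ| := by positivity
    have := mul_le_mul_of_nonneg_left (add_le_add_right this (1 + |ω|)) h2
    linarith

lemma stronglyMeasurable_smoothedSignal (hg : HasBoundedDerivs g g₁ g₂ g₃ K) (L : ℝ) :
    StronglyMeasurable fun p : ℝ × ℝ => smoothedSignal g g₁ L p.1 p.2 := by
  have hc : Continuous fun q : (ℝ × ℝ) × ℝ => signalTerm g g₁ q.1.1 q.1.2 (q.1.2 - q.2) :=
    hg.continuous_signalTerm.comp
      (f := fun q : (ℝ × ℝ) × ℝ => (q.1.1, q.1.2, q.1.2 - q.2)) (by fun_prop)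
  exact hc.stronglyMeasurable.integral_prod_right (ν := filterMeasure L)

lemma integral_mul_kern_dilated (hg : HasBoundedDerivs g g₁ g₂ g₃ K) {τ : ℝ}
    (hτ : |τ| ≤ 1 / 2) {L : ℝ} (hL : 0 < L) (ω : ℝ) :
    ∫ x, (1 - τ) ^ 2 * g ((1 - τ) * x) * kern L ω x = smoothedSignal g g₁ L τ ω := by
  have hK := hg.nonneg
  obtain ⟨hl, hr⟩ := abs_le.1 hτ
  have hc := hg.continuous₁
  have p2 : |(1 - τ) ^ 2| ≤ 4 := by
    rw [abs_of_nonneg (sq_nonneg _)]; nlinarith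
  have p3 : |(1 - τ) ^ 3| ≤ 4 := by
    rw [abs_of_nonneg (pow_nonneg (by linarith) 3)]
    have := pow_le_pow_left₀ (by linarith) (by linarith : 1 - τ ≤ 3 / 2) 3
    norm_num at this
    linarith
  refine integral_mul_kern_eq hL (u := fun x => (1 - τ) ^ 2 * g ((1 - τ) * x))
    (u₁ := fun x => (1 - τ) ^ 3 * g₁ ((1 - τ) * x)) (A := 4 * K) (fun x => ?_) (by fun_prop)
    (fun x => ?_) (fun x => ?_) ω
  · have h1 : HasDerivAt (fun x : ℝ => (1 - τ) * x) (1 - τ) x := by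
      simpa using (hasDerivAt_id' x).const_mul (1 - τ)
    have h2 : HasDerivAt (fun x : ℝ => g ((1 - τ) * x)) (g₁ ((1 - τ) * x) * (1 - τ)) x :=
      (hg.d1 _).comp x h1
    refine (h2.const_mul ((1 - τ) ^ 2)).congr_deriv ?_
    ring
  · rw [abs_mul]
    exact mul_le_mul p2 (hg.b0 _) (abs_nonneg _) (by norm_num)
  · rw [abs_mul]
    exact mul_le_mul p3 (hg.b1 _) (abs_nonneg _) (by norm_num)

end HasBoundedDerivs

end Signal

/-! ### The Neumann series -/

/-- The coefficient of the `i`-th term of `(I - L_{C₀})⁻¹ C₁ L_{C₂}`. -/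
def neumannCoeff (η : ℝ) (i : ℕ) : ℝ := (c0 η ^ i) ^ 3 * (c1 η * c2 η ^ 3)

/-- The frequency at which the `i`-th term of `(I - L_{C₀})⁻¹ C₁ L_{C₂} V` evaluates `V`. -/
def neumannFreq (η : ℝ) (i : ℕ) (ω : ℝ) : ℝ := c2 η * (c0 η ^ i * ω)

section Neumann

variable {η : ℝ}

lemma sqrt_three_mul_le_half (h1 : η ^ 2 ≤ 1 / 12) : √3 * η ≤ 1 / 2 := by
  refine le_of_sq_le_sq ?_ (by norm_num)
  rw [mul_pow, Real.sq_sqrt (by norm_num)]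
  linarith

lemma c0_nonneg (h0 : 0 < η) (h1 : η ^ 2 ≤ 1 / 12) : 0 ≤ c0 η := by
  have := sqrt_three_mul_le_half h1
  have : 0 < √3 * η := by positivity
  exact div_nonneg (by linarith) (by linarith)

lemma c0_lt_one (h0 : 0 < η) : c0 η < 1 := by
  have : 0 < √3 * η := by positivity
  rw [c0, div_lt_one (by linarith)]
  linarith

lemma c1_nonneg (h0 : 0 < η) : 0 ≤ c1 η := by unfold c1; positivity

lemma c2_nonneg (h0 : 0 < η) : 0 ≤ c2 η := by unfold c2; positivity

lemma c2_le_one (h0 : 0 < η) : c2 η ≤ 1 := by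
  have : 0 < √3 * η := by positivity
  rw [c2, div_le_one (by linarith)]
  linarith

lemma neumannCoeff_nonneg (h0 : 0 < η) (h1 : η ^ 2 ≤ 1 / 12) (i : ℕ) : 0 ≤ neumannCoeff η i := by
  have := c0_nonneg h0 h1
  have := c1_nonneg h0
  have := c2_nonneg h0
  unfold neumannCoeff
  positivity

lemma neumannCoeff_le (h0 : 0 < η) (h1 : η ^ 2 ≤ 1 / 12) (i : ℕ) :
    neumannCoeff η i ≤ c1 η * c2 η * c0 η ^ i := by
  have a0 := c0_nonneg h0 h1
  have a1 := c1_nonneg h0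
  have a2 := c2_nonneg h0
  have b : (c0 η ^ i) ^ 3 ≤ c0 η ^ i :=
    pow_le_of_le_one (pow_nonneg a0 i) (pow_le_one₀ a0 (c0_lt_one h0).le) (by norm_num)
  have b2 : c2 η ^ 3 ≤ c2 η := pow_le_of_le_one a2 (c2_le_one h0) (by norm_num)
  rw [neumannCoeff, mul_comm]
  gcongr

lemma hasSum_geometric_bound (h0 : 0 < η) (h1 : η ^ 2 ≤ 1 / 12) :
    HasSum (fun i : ℕ => c1 η * c2 η * c0 η ^ i) 1 := by
  have h := (hasSum_geometric_of_lt_one (c0_nonneg h0 h1) (c0_lt_one h0)).mul_left (c1 η * c2 η)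
  have hp : 0 < √3 * η := by positivity
  have e : 1 - c0 η = c1 η * c2 η := by
    rw [c0, c1, c2]
    field_simp
    ring
  have e2 : 0 < c1 η * c2 η := by
    rw [c1, c2]; positivity
  rwa [e, mul_inv_cancel₀ e2.ne'] at h

lemma summable_neumannCoeff (h0 : 0 < η) (h1 : η ^ 2 ≤ 1 / 12) : Summable (neumannCoeff η) :=
  Summable.of_nonneg_of_le (neumannCoeff_nonneg h0 h1) (neumannCoeff_le h0 h1)
    (hasSum_geometric_bound h0 h1).summable

/-- The operator `(I - L_{C₀})⁻¹ C₁ L_{C₂}` is bounded uniformly in `η`: the factor `C₁ = O(η)`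
compensates for `1 / (1 - C₀) = O(1 / η)`. -/
lemma tsum_neumannCoeff_le_one (h0 : 0 < η) (h1 : η ^ 2 ≤ 1 / 12) :
    ∑' i, neumannCoeff η i ≤ 1 :=
  ((summable_neumannCoeff h0 h1).tsum_le_tsum (neumannCoeff_le h0 h1)
    (hasSum_geometric_bound h0 h1).summable).trans_eq (hasSum_geometric_bound h0 h1).tsum_eq

lemma abs_neumannFreq_le (h0 : 0 < η) (h1 : η ^ 2 ≤ 1 / 12) (i : ℕ) (ω : ℝ) :
    |neumannFreq η i ω| ≤ |ω| := by
  have a0 := c0_nonneg h0 h1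
  have b := pow_le_one₀ a0 (c0_lt_one h0).le (n := i)
  rw [neumannFreq, abs_mul, abs_mul, abs_of_nonneg (c2_nonneg h0),
    abs_of_nonneg (pow_nonneg a0 i)]
  exact (mul_le_of_le_one_left (by positivity) (c2_le_one h0)).trans
    (mul_le_of_le_one_left (abs_nonneg _) b)

lemma iterate_dilate_eq_neumann (V : ℝ → ℝ) (i : ℕ) (ω : ℝ) :
    ((dilate (c0 η))^[i] fun ω => c1 η * dilate (c2 η) V ω) ω =
      neumannCoeff η i * V (neumannFreq η i ω) := by
  rw [iterate_dilate, dilate, neumannCoeff, neumannFreq]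
  ring

lemma summable_neumann (h0 : 0 < η) (h1 : η ^ 2 ≤ 1 / 12) {V : ℝ → ℝ} {ω B : ℝ}
    (hV : ∀ ω', |ω'| ≤ |ω| → |V ω'| ≤ B) :
    Summable fun i => neumannCoeff η i * V (neumannFreq η i ω) := by
  refine Summable.of_norm_bounded ((summable_neumannCoeff h0 h1).mul_right B) fun i => ?_
  rw [norm_mul, Real.norm_eq_abs, Real.norm_eq_abs, abs_of_nonneg (neumannCoeff_nonneg h0 h1 i)]
  exact mul_le_mul_of_nonneg_left (hV _ (abs_neumannFreq_le h0 h1 i ω))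
    (neumannCoeff_nonneg h0 h1 i)

/-- The unbiasing identity: the Neumann series recovers `g` from the mean over the dilations. -/
lemma hasSum_neumann_dilationMean (h0 : 0 < η) (h1 : η ^ 2 ≤ 1 / 12) {g : ℝ → ℝ}
    (hg : Continuous g) (ω : ℝ) :
    HasSum (fun i => neumannCoeff η i * dilationMean g (√3 * η) (neumannFreq η i ω)) (g ω) := by
  have hp : 0 < √3 * η := by positivity
  have hterm : ∀ i, neumannCoeff η i * dilationMean g (√3 * η) (neumannFreq η i ω) =
      (c0 η ^ i) ^ 3 * g (c0 η ^ i * ω) - (c0 η ^ (i + 1)) ^ 3 * g (c0 η ^ (i + 1) * ω) := by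
    intro i
    have e1 : (1 + √3 * η) * neumannFreq η i ω = c0 η ^ i * ω := by
      rw [neumannFreq, c2]; field_simp
    have e2 : (1 - √3 * η) * neumannFreq η i ω = c0 η ^ (i + 1) * ω := by
      rw [neumannFreq, c2, pow_succ]
      nth_rewrite 3 [c0]
      field_simp
    have e3 : c0 η * (1 + √3 * η) = 1 - √3 * η := by
      rw [c0]; field_simp
    have e4 : c1 η * (2 * (√3 * η))⁻¹ = 1 := by
      rw [c1]; field_simp
    have e5 : c2 η * (1 + √3 * η) = 1 := by
      rw [c2]; field_simp
    rw [dilationMean, e1, e2, neumannCoeff, ← e3]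
    calc _ = (c1 η * (2 * (√3 * η))⁻¹) * ((c2 η * (1 + √3 * η)) ^ 3 *
          ((c0 η ^ i) ^ 3 * g (c0 η ^ i * ω) -
            (c0 η ^ (i + 1)) ^ 3 * g (c0 η ^ (i + 1) * ω))) := by ring
      _ = _ := by rw [e4, e5]; ring
  have hsum : Summable fun i =>
      neumannCoeff η i * dilationMean g (√3 * η) (neumannFreq η i ω) := by
    have hc : Continuous (dilationMean g (√3 * η)) := by
      unfold dilationMean; fun_prop
    obtain ⟨B, hB⟩ := (isCompact_Icc (a := -|ω|) (b := |ω|)).exists_bound_of_continuousOn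
      hc.continuousOn
    exact summable_neumann h0 h1 fun ω' hω' => hB ω' (abs_le.1 hω')
  refine (hsum.hasSum_iff_tendsto_nat).2 ?_
  have hpow := tendsto_pow_atTop_nhds_zero_of_lt_one (c0_nonneg h0 h1) (c0_lt_one h0)
  have hlim : Tendsto (fun n : ℕ => (c0 η ^ n) ^ 3 * g (c0 η ^ n * ω)) atTop (𝓝 (0 ^ 3 * g 0)) := by
    refine (hpow.pow 3).mul (hg.continuousAt.tendsto.comp ?_)
    simpa using hpow.mul_const ω
  have e : ∀ n, ∑ i ∈ Finset.range n,
      neumannCoeff η i * dilationMean g (√3 * η) (neumannFreq η i ω) =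
        g ω - (c0 η ^ n) ^ 3 * g (c0 η ^ n * ω) := by
    intro n
    simp_rw [hterm]
    rw [Finset.sum_range_sub' (fun i => (c0 η ^ i) ^ 3 * g (c0 η ^ i * ω))]
    simp
  simp_rw [e]
  simpa using hlim.const_sub (g ω)

/-- Pointwise error bound: Cauchy–Schwarz for the Neumann series, whose coefficients sum to at most
`1`. -/
lemma enorm_sq_tsum_neumann_le (h0 : 0 < η) (h1 : η ^ 2 ≤ 1 / 12) (r : ℝ → ℝ) (ω : ℝ) :
    ‖∑' i, neumannCoeff η i * r (neumannFreq η i ω)‖ₑ ^ 2 ≤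
      ∑' i, ENNReal.ofReal (neumannCoeff η i) * ‖r (neumannFreq η i ω)‖ₑ ^ 2 := by
  have hone : ∑' i, ENNReal.ofReal (neumannCoeff η i) ≤ 1 := by
    rw [← ENNReal.ofReal_tsum_of_nonneg (neumannCoeff_nonneg h0 h1) (summable_neumannCoeff h0 h1)]
    exact ENNReal.ofReal_le_one.2 (tsum_neumannCoeff_le_one h0 h1)
  have hcs := sq_lintegral_mul_le (μ := Measure.count)
    (a := fun i => ENNReal.ofReal (neumannCoeff η i)) (b := fun i => ‖r (neumannFreq η i ω)‖ₑ)
    Measurable.of_discrete Measurable.of_discrete.aemeasurable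
  simp only [lintegral_count] at hcs
  have hle : ‖∑' i, neumannCoeff η i * r (neumannFreq η i ω)‖ₑ ≤
      ∑' i, ENNReal.ofReal (neumannCoeff η i) * ‖r (neumannFreq η i ω)‖ₑ := by
    refine enorm_tsum_le_tsum_enorm.trans_eq (tsum_congr fun i => ?_)
    rw [enorm_mul, Real.enorm_of_nonneg (neumannCoeff_nonneg h0 h1 i)]
  calc _ ≤ (∑' i, ENNReal.ofReal (neumannCoeff η i) * ‖r (neumannFreq η i ω)‖ₑ) ^ 2 := by gcongr
    _ ≤ _ := hcs
    _ ≤ 1 * _ := by gcongr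
    _ = _ := one_mul _

end Neumann

/-! ### Averages of independent centred variables -/

section Averages

variable {S : Type*} [MeasurableSpace S] {P : Measure S}

lemma lintegral_enorm_sq_eq {Z : S → ℝ} (hZ : MemLp Z 2 P) :
    ∫⁻ s, ‖Z s‖ₑ ^ 2 ∂P = ENNReal.ofReal (∫ s, Z s ^ 2 ∂P) := by
  rw [ofReal_integral_eq_lintegral_ofReal hZ.integrable_sq
    (Eventually.of_forall fun s => sq_nonneg _)]
  refine lintegral_congr fun s => ?_
  rw [← sq_abs, ENNReal.ofReal_pow (abs_nonneg _), ← Real.enorm_eq_ofReal_abs]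

/-- The average of `M` independent centred variables of variance at most `B` has variance at most
`B / M`. -/
lemma lintegral_sq_average_le [IsProbabilityMeasure P] {M : ℕ} (hM : 1 ≤ M) {X : Fin M → S → ℝ}
    {B : ℝ} (h2 : ∀ j, MemLp (X j) 2 P) (hi : iIndepFun X P) (h0 : ∀ j, ∫ s, X j s ∂P = 0)
    (hB : ∀ j, ∫ s, X j s ^ 2 ∂P ≤ B) :
    ∫⁻ s, ‖(M : ℝ)⁻¹ * ∑ j, X j s‖ₑ ^ 2 ∂P ≤ ENNReal.ofReal (B / M) := by
  have hM' : (0 : ℝ) < M := by exact_mod_cast hM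
  have hsum : MemLp (∑ j, X j) 2 P := memLp_finsetSum' _ fun j _ => h2 j
  have hvar := IndepFun.variance_sum (s := Finset.univ) (fun j _ => h2 j)
    (fun i _ j _ hij => hi.indepFun hij)
  have hmean : ∫ s, (∑ j, X j) s ∂P = 0 := by
    simp_rw [Finset.sum_apply]
    rw [integral_finsetSum _ fun j _ => (h2 j).integrable (by norm_num)]
    simp [h0]
  rw [variance_of_integral_eq_zero hsum.aestronglyMeasurable.aemeasurable hmean] at hvar
  have hle : ∫ s, (∑ j, X j) s ^ 2 ∂P ≤ M * B := by
    rw [hvar]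
    refine (Finset.sum_le_card_nsmul _ _ B fun j _ => ?_).trans_eq (by simp)
    rw [variance_of_integral_eq_zero (h2 j).aestronglyMeasurable.aemeasurable (h0 j)]
    exact hB j
  have hZ : MemLp (fun s => (M : ℝ)⁻¹ * ∑ j, X j s) 2 P := by
    have := hsum.const_mul (M : ℝ)⁻¹
    simpa using this
  rw [lintegral_enorm_sq_eq hZ]
  refine ENNReal.ofReal_le_ofReal ?_
  simp_rw [mul_pow]
  rw [integral_const_mul]
  simp_rw [← Finset.sum_apply]
  calc ((M : ℝ)⁻¹) ^ 2 * ∫ s, (∑ j, X j) s ^ 2 ∂P ≤ ((M : ℝ)⁻¹) ^ 2 * (M * B) := by gcongr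
    _ = B / M := by field_simp

end Averages

/-! ### The law of the dilations -/

section Uniform

variable {S : Type*} [MeasurableSpace S] {P : Measure S}

lemma integral_comp_of_isUniform {τ : S → ℝ} (hτ : Measurable τ) {a b : ℝ} (hab : a < b)
    (hu : pdf.IsUniform τ (Set.Icc a b) P volume) {φ : ℝ → ℝ} (hφ : Measurable φ) :
    ∫ s, φ (τ s) ∂P = (b - a)⁻¹ * ∫ x in a..b, φ x := by
  rw [← integral_map hτ.aemeasurable hφ.aestronglyMeasurable, hu, ProbabilityTheory.cond,
    integral_smul_measure, Real.volume_Icc, intervalIntegral.integral_of_le hab.le,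
    integral_Icc_eq_integral_Ioc,
    ENNReal.toReal_inv, ENNReal.toReal_ofReal (by linarith), smul_eq_mul]

/-- A uniform variable with mean `0` and variance `η²` is uniform on `[-√3 η, √3 η]`. -/
lemma isUniform_symm [IsProbabilityMeasure P] {τ : S → ℝ} (hτ : Measurable τ) {η : ℝ}
    (hη : 0 < η) (hu : ∃ a b : ℝ, a < b ∧ pdf.IsUniform τ (Set.Icc a b) P volume)
    (hmean : ∫ s, τ s ∂P = 0) (hvar : variance τ P = η ^ 2) :
    pdf.IsUniform τ (Set.Icc (-(√3 * η)) (√3 * η)) P volume := by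
  obtain ⟨a, b, hab, hu⟩ := hu
  have h1 := integral_comp_of_isUniform hτ hab hu (φ := fun x => x) measurable_id
  rw [hmean, integral_id] at h1
  have hba : b - a ≠ 0 := (sub_pos.2 hab).ne'
  have ha : a = -b := by
    have : (b - a) * (b + a) = 0 := by
      field_simp at h1
      linarith
    rcases mul_eq_zero.1 this with h | h
    · exact absurd h hba
    · linarith
  have h2 := integral_comp_of_isUniform hτ hab hu (φ := fun x => x ^ 2) (by fun_prop)
  rw [variance_of_integral_eq_zero hτ.aemeasurable hmean] at hvar
  rw [hvar, integral_pow, ha] at h2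
  have hb : 0 < b := by linarith
  have hb2 : b ^ 2 = 3 * η ^ 2 := by
    have e : (b - -b)⁻¹ * ((b ^ (2 + 1) - (-b) ^ (2 + 1)) / ((2 : ℕ) + 1)) = b ^ 2 / 3 := by
      push_cast
      field_simp
      ring
    rw [e] at h2
    linarith
  have hb3 : b = √3 * η := by
    rw [← Real.sqrt_sq hb.le, hb2, Real.sqrt_mul (by norm_num), Real.sqrt_sq hη.le]
  rw [ha, hb3] at hu
  exact hu

lemma ae_abs_le_of_isUniform {τ : S → ℝ} (hτ : Measurable τ) {h : ℝ}
    (hu : pdf.IsUniform τ (Set.Icc (-h) h) P volume) : ∀ᵐ s ∂P, |τ s| ≤ h := by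
  have h1 : ∀ᵐ x ∂(P.map τ), x ∈ Set.Icc (-h) h := by
    rw [hu]
    exact ae_cond_mem measurableSet_Icc
  filter_upwards [ae_of_ae_map hτ.aemeasurable h1] with s hs
  exact abs_le.2 hs

end Uniform

/-! ### Moments of the noise -/

/-- The fourth moment of the standard Gaussian. -/
def gaussianFourthMoment : ℝ := ∫ x, x ^ 4 ∂gaussianReal 0 1

lemma gaussianFourthMoment_nonneg : 0 ≤ gaussianFourthMoment :=
  integral_nonneg fun x => by positivity

lemma integral_pow_four_gaussianReal (v : NNReal) :
    ∫ x, x ^ 4 ∂gaussianReal 0 v = gaussianFourthMoment * (v : ℝ) ^ 2 := by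
  have h := gaussianReal_map_const_mul (μ := 0) (v := 1) (√v)
  have hv : NNReal.mk ((√v : ℝ) ^ 2) (sq_nonneg _) * 1 = v := by
    ext
    simp [Real.sq_sqrt v.coe_nonneg]
  rw [hv, mul_zero] at h
  rw [← h, integral_map (by fun_prop) (by fun_prop)]
  simp_rw [mul_pow]
  rw [integral_const_mul, gaussianFourthMoment]
  have : (√(v : ℝ)) ^ 4 = (v : ℝ) ^ 2 := by
    rw [show 4 = 2 * 2 from rfl, pow_mul, Real.sq_sqrt v.coe_nonneg]
  rw [this, mul_comm]

section GaussianVariable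

variable {S : Type*} [MeasurableSpace S] {P : Measure S} {A : S → ℝ} {v : NNReal}

lemma integrable_pow_of_map_gaussian (hA : AEMeasurable A P) (hl : P.map A = gaussianReal 0 v)
    (n : ℕ) (hn : n ≠ 0) : Integrable (fun s => A s ^ n) P := by
  have h : Integrable (fun x : ℝ => x ^ n) (P.map A) := by
    rw [hl]
    have h := (memLp_id_gaussianReal' (μ := 0) (v := v) n (by simp)).integrable_norm_pow hn
    refine h.mono' (by fun_prop) (Eventually.of_forall fun y => ?_)
    simp
  exact h.comp_aemeasurable hA

lemma integral_of_map_gaussian (hA : AEMeasurable A P) (hl : P.map A = gaussianReal 0 v) :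
    ∫ s, A s ∂P = 0 := by
  rw [← integral_id_gaussianReal (μ := 0) (v := v), ← hl,
    integral_map hA (by fun_prop)]

lemma integral_sq_of_map_gaussian (hA : AEMeasurable A P) (hl : P.map A = gaussianReal 0 v) :
    ∫ s, A s ^ 2 ∂P = v := by
  rw [← variance_fun_id_gaussianReal (μ := 0) (v := v),
    variance_of_integral_eq_zero (by fun_prop) integral_id_gaussianReal, ← hl,
    integral_map hA (by fun_prop)]

lemma integral_pow_four_of_map_gaussian (hA : AEMeasurable A P)
    (hl : P.map A = gaussianReal 0 v) :
    ∫ s, A s ^ 4 ∂P = gaussianFourthMoment * (v : ℝ) ^ 2 := by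
  rw [← integral_pow_four_gaussianReal, ← hl, integral_map hA (by fun_prop)]

/-- First and second moment of `X = |F + z|² - |F|² - σ² = 2 Re(F̄ z) + |z|² - σ²`, where
`F = p + i q` is bounded and independent of the complex Gaussian `z = A - i B` with
`E|z|² = σ²`. -/
lemma noise_moments [IsProbabilityMeasure P] {B p q : S → ℝ} {w : NNReal} {σ K : ℝ}
    (hA : AEMeasurable A P) (hB : AEMeasurable B P) (hp : AEMeasurable p P) (hq : AEMeasurable q P)
    (hAl : P.map A = gaussianReal 0 v) (hBl : P.map B = gaussianReal 0 w)
    (hvw : (v : ℝ) + w = σ ^ 2) (hpK : ∀ᵐ s ∂P, |p s| ≤ K) (hqK : ∀ᵐ s ∂P, |q s| ≤ K)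
    (hpA : IndepFun p A P) (hqB : IndepFun q B P) :
    let X := fun s => 2 * (p s * A s - q s * B s) + (A s ^ 2 + B s ^ 2) - σ ^ 2
    MemLp X 2 P ∧ ∫ s, X s ∂P = 0 ∧
      ∫ s, X s ^ 2 ∂P ≤ (16 * K ^ 2 + 12 * gaussianFourthMoment + 6) * max (σ ^ 2) (σ ^ 4) := by
  intro X
  have iA : Integrable A P := by simpa using integrable_pow_of_map_gaussian hA hAl 1 one_ne_zero
  have iB : Integrable B P := by simpa using integrable_pow_of_map_gaussian hB hBl 1 one_ne_zero
  have iA2 := integrable_pow_of_map_gaussian hA hAl 2 two_ne_zero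
  have iB2 := integrable_pow_of_map_gaussian hB hBl 2 two_ne_zero
  have iA4 := integrable_pow_of_map_gaussian hA hAl 4 four_ne_zero
  have iB4 := integrable_pow_of_map_gaussian hB hBl 4 four_ne_zero
  have ipA : Integrable (fun s => p s * A s) P := iA.bdd_mul hp.aestronglyMeasurable hpK
  have iqB : Integrable (fun s => q s * B s) P := iB.bdd_mul hq.aestronglyMeasurable hqK
  have hXm : AEMeasurable X P := by
    simp only [X]; fun_prop
  set Z : S → ℝ := fun s => 16 * K ^ 2 * (A s ^ 2 + B s ^ 2) + 6 * (A s ^ 4 + B s ^ 4) + 6 * σ ^ 4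
    with hZ
  have i1 : Integrable (fun s => 16 * K ^ 2 * (A s ^ 2 + B s ^ 2)) P := (iA2.add iB2).const_mul _
  have i2 : Integrable (fun s => 6 * (A s ^ 4 + B s ^ 4)) P := (iA4.add iB4).const_mul _
  have i12 : Integrable
      (fun s => 16 * K ^ 2 * (A s ^ 2 + B s ^ 2) + 6 * (A s ^ 4 + B s ^ 4)) P := i1.add i2
  have iZ : Integrable Z P := i12.add (integrable_const _)
  have hXZ : ∀ᵐ s ∂P, X s ^ 2 ≤ Z s := by
    filter_upwards [hpK, hqK] with s h1 h2
    have h1' : p s ^ 2 ≤ K ^ 2 := sq_le_sq' (abs_le.1 h1).1 (abs_le.1 h1).2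
    have h2' : q s ^ 2 ≤ K ^ 2 := sq_le_sq' (abs_le.1 h2).1 (abs_le.1 h2).2
    have e1 := mul_le_mul_of_nonneg_right h1' (sq_nonneg (A s))
    have e2 := mul_le_mul_of_nonneg_right h2' (sq_nonneg (B s))
    have e3 : X s ^ 2 ≤ 2 * (2 * (p s * A s - q s * B s)) ^ 2 +
        2 * (A s ^ 2 + B s ^ 2 - σ ^ 2) ^ 2 := by
      simp only [X]
      nlinarith [sq_nonneg (2 * (p s * A s - q s * B s) - (A s ^ 2 + B s ^ 2 - σ ^ 2))]
    have e4 : (p s * A s - q s * B s) ^ 2 ≤ 2 * (p s ^ 2 * A s ^ 2 + q s ^ 2 * B s ^ 2) := by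
      nlinarith [sq_nonneg (p s * A s + q s * B s)]
    have e5 : (A s ^ 2 + B s ^ 2 - σ ^ 2) ^ 2 ≤ 3 * (A s ^ 4 + B s ^ 4 + σ ^ 4) := by
      nlinarith [sq_nonneg (A s ^ 2 - B s ^ 2), sq_nonneg (A s ^ 2 + σ ^ 2),
        sq_nonneg (B s ^ 2 + σ ^ 2)]
    simp only [hZ]
    nlinarith
  have hX2 : Integrable (fun s => X s ^ 2) P :=
    iZ.mono' (hXm.pow_const 2).aestronglyMeasurable (by
      filter_upwards [hXZ] with s hs
      rwa [Real.norm_eq_abs, abs_of_nonneg (sq_nonneg _)])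
  refine ⟨(memLp_two_iff_integrable_sq hXm.aestronglyMeasurable).2 hX2, ?_, ?_⟩
  · have hpA0 : ∫ s, p s * A s ∂P = 0 := by
      have := hpA.integral_mul_eq_mul_integral hp.aestronglyMeasurable hA.aestronglyMeasurable
      simpa [integral_of_map_gaussian hA hAl] using this
    have hqB0 : ∫ s, q s * B s ∂P = 0 := by
      have := hqB.integral_mul_eq_mul_integral hq.aestronglyMeasurable hB.aestronglyMeasurable
      simpa [integral_of_map_gaussian hB hBl] using this
    have j1 : Integrable (fun s => 2 * (p s * A s - q s * B s)) P := (ipA.sub iqB).const_mul 2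
    have j2 : Integrable (fun s => A s ^ 2 + B s ^ 2) P := iA2.add iB2
    have j3 : Integrable (fun s => 2 * (p s * A s - q s * B s) + (A s ^ 2 + B s ^ 2)) P :=
      j1.add j2
    simp only [X]
    rw [integral_sub j3 (integrable_const _), integral_add j1 j2, integral_const_mul,
      integral_sub ipA iqB, integral_add iA2 iB2, hpA0, hqB0, integral_sq_of_map_gaussian hA hAl,
      integral_sq_of_map_gaussian hB hBl, hvw]
    simp
  · refine (integral_mono_ae hX2 iZ hXZ).trans ?_
    simp only [hZ]
    rw [integral_add i12 (integrable_const _), integral_add i1 i2, integral_const_mul,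
      integral_const_mul, integral_add iA2 iB2, integral_add iA4 iB4,
      integral_sq_of_map_gaussian hA hAl, integral_sq_of_map_gaussian hB hBl,
      integral_pow_four_of_map_gaussian hA hAl, integral_pow_four_of_map_gaussian hB hBl, hvw]
    simp only [integral_const, probReal_univ, one_smul]
    have hm := gaussianFourthMoment_nonneg
    have hv : (v : ℝ) ^ 2 + (w : ℝ) ^ 2 ≤ σ ^ 4 := by
      have : σ ^ 4 = ((v : ℝ) + w) ^ 2 := by rw [hvw]; ring
      rw [this]
      nlinarith [mul_nonneg v.coe_nonneg w.coe_nonneg]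
    have l2 := le_max_left (σ ^ 2) (σ ^ 4)
    have l4 := le_max_right (σ ^ 2) (σ ^ 4)
    have k1 := mul_le_mul_of_nonneg_left l2 (by positivity : 0 ≤ 16 * K ^ 2)
    have k2 := mul_le_mul_of_nonneg_left (hv.trans l4) hm
    have k3 : 0 ≤ gaussianFourthMoment * max (σ ^ 2) (σ ^ 4) :=
      mul_nonneg hm ((sq_nonneg σ).trans l2)
    linarith

end GaussianVariable

lemma norm_cosLp_sq_add_norm_sinLp_sq (ω : ℝ) : ‖cosLp ω‖ ^ 2 + ‖sinLp ω‖ ^ 2 = 1 := by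
  have hc : ‖cosLp ω‖ ^ 2 = ∫ x, Real.cos (x * ω) ^ 2 ∂boxMeasure := by
    rw [← real_inner_self_eq_norm_sq, L2.inner_def]
    refine integral_congr_ae ?_
    filter_upwards [(memLp_cos ω).coeFn_toLp] with x hx
    rw [cosLp, hx]
    simp [pow_two]
  have hs : ‖sinLp ω‖ ^ 2 = ∫ x, Real.sin (x * ω) ^ 2 ∂boxMeasure := by
    rw [← real_inner_self_eq_norm_sq, L2.inner_def]
    refine integral_congr_ae ?_
    filter_upwards [(memLp_sin ω).coeFn_toLp] with x hx
    rw [sinLp, hx]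
    simp [pow_two]
  rw [hc, hs, ← integral_add (memLp_cos ω).integrable_sq (memLp_sin ω).integrable_sq]
  simp only [Real.cos_sq_add_sin_sq]
  simp [Measure.real]
  norm_num

/-! ### The observations -/

/-- The Fourier transform of the signal translated by `t` and dilated by `1 - τ`. -/
def signalHat (f : ℝ → ℝ) (τ t ω : ℝ) : ℂ :=
  ((1 - τ : ℝ) : ℂ) * (Complex.exp (-(Complex.I * (t : ℂ) * (ω : ℂ))) * hat f ((1 - τ) * ω))

/-- The centred noise contribution to the power spectrum of an observation whose noise has Fourier
transform `z` at `ω`. -/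
def noiseTerm (f : ℝ → ℝ) (σ τ t : ℝ) (z : ℂ) (ω : ℝ) : ℝ :=
  ‖signalHat f τ t ω + z‖ ^ 2 - ‖signalHat f τ t ω‖ ^ 2 - σ ^ 2

/-- The average of the noise contributions to the power spectrum over the observations. -/
def meanNoise {S : Type*} (f : ℝ → ℝ) (σ : ℝ) {M : ℕ} (t τ : Fin M → S → ℝ)
    (e : Fin M → ℝ → S → ℂ) (ω : ℝ) (s : S) : ℝ :=
  (M : ℝ)⁻¹ * ∑ j, noiseTerm f σ (τ j s) (t j s) (e j ω s) ω

section Observations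

variable {f : ℝ → ℝ} {g₁ g₂ g₃ : ℝ → ℝ} {K : ℝ}

lemma norm_signalHat_sq (f : ℝ → ℝ) (τ t ω : ℝ) :
    ‖signalHat f τ t ω‖ ^ 2 = (1 - τ) ^ 2 * powerSpectrum f ((1 - τ) * ω) := by
  have e : -(Complex.I * (t : ℂ) * (ω : ℂ)) = ((-(t * ω) : ℝ) : ℂ) * Complex.I := by
    push_cast; ring
  rw [signalHat, e, norm_mul, norm_mul, Complex.norm_exp_ofReal_mul_I, powerSpectrum,
    Complex.norm_real, Real.norm_eq_abs, one_mul, mul_pow, sq_abs]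

lemma continuous_signalHat (hf : MemLp f 2) (hfc : HasCompactSupport f) :
    Continuous fun p : ℝ × ℝ × ℝ => signalHat f p.1 p.2.1 p.2.2 := by
  have := continuous_hat hf hfc
  unfold signalHat
  fun_prop

lemma norm_signalHat_le (hg : HasBoundedDerivs (powerSpectrum f) g₁ g₂ g₃ K) {τ : ℝ}
    (hτ : |τ| ≤ 1 / 2) (t ω : ℝ) : ‖signalHat f τ t ω‖ ≤ 2 * √K := by
  refine le_of_sq_le_sq ?_ (by positivity)
  obtain ⟨hl, hr⟩ := abs_le.1 hτ
  rw [norm_signalHat_sq, mul_pow, Real.sq_sqrt hg.nonneg]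
  have h1 : (1 - τ) ^ 2 ≤ 2 ^ 2 := by nlinarith
  exact mul_le_mul h1 ((le_abs_self _).trans (hg.b0 _)) (sq_nonneg _) (by norm_num)

lemma measurable_noiseTerm (hf : MemLp f 2) (hfc : HasCompactSupport f) (σ : ℝ) :
    Measurable fun p : ℝ × ℝ × ℂ × ℝ => noiseTerm f σ p.1 p.2.1 p.2.2.1 p.2.2.2 := by
  have h : Continuous fun p : ℝ × ℝ × ℂ × ℝ => signalHat f p.1 p.2.1 p.2.2.2 :=
    (continuous_signalHat hf hfc).comp
      (f := fun p : ℝ × ℝ × ℂ × ℝ => (p.1, p.2.1, p.2.2.2)) (by fun_prop)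
  unfold noiseTerm
  fun_prop

lemma noiseTerm_eq (f : ℝ → ℝ) (σ τ t a b ω : ℝ) :
    noiseTerm f σ τ t ((a : ℂ) - Complex.I * (b : ℂ)) ω =
      2 * ((signalHat f τ t ω).re * a - (signalHat f τ t ω).im * b) + (a ^ 2 + b ^ 2)
        - σ ^ 2 := by
  rw [noiseTerm, ← Complex.normSq_eq_norm_sq, ← Complex.normSq_eq_norm_sq, Complex.normSq_apply,
    Complex.normSq_apply]
  simp
  ring

end Observations

section Model

variable {S : Type*} [MeasurableSpace S] {P : Measure S} {f : ℝ → ℝ} {η σ : ℝ} {M : ℕ}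
  {t τ : Fin M → S → ℝ} {W : Fin M → (Lp ℝ 2 boxMeasure →ₗ[ℝ] Lp ℝ 2 P)}
  {e : Fin M → ℝ → S → ℂ} {g₁ g₂ g₃ : ℝ → ℝ} {K : ℝ}

namespace NoisyDilationModel

lemma isUniform [IsProbabilityMeasure P] (hm : NoisyDilationModel P f η σ M t τ W e) (hη : 0 < η)
    (j : Fin M) : pdf.IsUniform (τ j) (Set.Icc (-(√3 * η)) (√3 * η)) P volume :=
  isUniform_symm (hm.measurable_τ j) hη (hm.uniform_τ j) (hm.mean_τ j) (hm.variance_τ j)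

lemma ae_abs_τ_le [IsProbabilityMeasure P] (hm : NoisyDilationModel P f η σ M t τ W e)
    (hη : 0 < η) (j : Fin M) : ∀ᵐ s ∂P, |τ j s| ≤ √3 * η :=
  ae_abs_le_of_isUniform (hm.measurable_τ j) (hm.isUniform hη j)

lemma ae_abs_τ_le_half [IsProbabilityMeasure P] (hm : NoisyDilationModel P f η σ M t τ W e)
    (hη : 0 < η) (hη' : η ^ 2 ≤ 1 / 12) (j : Fin M) : ∀ᵐ s ∂P, |τ j s| ≤ 1 / 2 := by
  filter_upwards [hm.ae_abs_τ_le hη j] with s hs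
  exact hs.trans (sqrt_three_mul_le_half hη')

lemma measurable_meanNoise (hm : NoisyDilationModel P f η σ M t τ W e) (hf : MemLp f 2)
    (hfc : HasCompactSupport f) : Measurable (Function.uncurry (meanNoise f σ t τ e)) := by
  unfold meanNoise Function.uncurry
  refine Measurable.const_mul (Finset.measurable_sum _ fun j _ => ?_) _
  have h1 := hm.measurable_t j
  have h2 := hm.measurable_τ j
  have h3 : Measurable fun p : ℝ × S => e j p.1 p.2 := (hm.noiseFourier j).measurable
  exact (measurable_noiseTerm hf hfc σ).comp
    (f := fun p : ℝ × S => (τ j p.2, t j p.2, e j p.1 p.2, p.1)) (by fun_prop)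

lemma iIndepFun_noiseTerm (hm : NoisyDilationModel P f η σ M t τ W e) (hf : MemLp f 2)
    (hfc : HasCompactSupport f) (ω : ℝ) :
    iIndepFun (fun j s => noiseTerm f σ (τ j s) (t j s) (e j ω s) ω) P := by
  have h := hm.indep.comp (fun _ p => noiseTerm f σ p.2.1 p.1
    (((p.2.2 (cosLp ω) : ℝ) : ℂ) - Complex.I * ((p.2.2 (sinLp ω) : ℝ) : ℂ)) ω) (fun _ => by
      refine (measurable_noiseTerm hf hfc σ).comp
        (f := fun p : ℝ × ℝ × (Lp ℝ 2 boxMeasure → ℝ) => (p.2.1, p.1,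
          ((p.2.2 (cosLp ω) : ℝ) : ℂ) - Complex.I * ((p.2.2 (sinLp ω) : ℝ) : ℂ), ω)) ?_
      have h1 : Measurable fun p : ℝ × ℝ × (Lp ℝ 2 boxMeasure → ℝ) => p.2.2 (cosLp ω) :=
        (measurable_pi_apply _).comp (measurable_snd.comp measurable_snd)
      have h2 : Measurable fun p : ℝ × ℝ × (Lp ℝ 2 boxMeasure → ℝ) => p.2.2 (sinLp ω) :=
        (measurable_pi_apply _).comp (measurable_snd.comp measurable_snd)
      fun_prop)
  refine h.congr fun j => ?_
  filter_upwards [(hm.noiseFourier j).ae_eq ω] with s hs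
  simp only [Function.comp]
  rw [hs]

/-- The noise contributions are centred, with variance `O(σ² ∨ σ⁴)` at every frequency. -/
lemma noiseTerm_moments [IsProbabilityMeasure P] (hm : NoisyDilationModel P f η σ M t τ W e)
    (hη : 0 < η) (hη' : η ^ 2 ≤ 1 / 12) (hf : MemLp f 2) (hfc : HasCompactSupport f)
    (hg : HasBoundedDerivs (powerSpectrum f) g₁ g₂ g₃ K) (ω : ℝ) (j : Fin M) :
    MemLp (fun s => noiseTerm f σ (τ j s) (t j s) (e j ω s) ω) 2 P ∧
      ∫ s, noiseTerm f σ (τ j s) (t j s) (e j ω s) ω ∂P = 0 ∧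
      ∫ s, noiseTerm f σ (τ j s) (t j s) (e j ω s) ω ^ 2 ∂P ≤
        (64 * K + 12 * gaussianFourthMoment + 6) * max (σ ^ 2) (σ ^ 4) := by
  have hc := (continuous_signalHat hf hfc).measurable
  have h1 := hm.measurable_t j
  have h2 := hm.measurable_τ j
  have hF : Measurable fun p : ℝ × ℝ => signalHat f p.2 p.1 ω :=
    hc.comp (f := fun p : ℝ × ℝ => (p.2, p.1, ω)) (by fun_prop)
  have hFs : Measurable fun s => signalHat f (τ j s) (t j s) ω :=
    hF.comp (f := fun s => (t j s, τ j s)) (by fun_prop)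
  have hev : ∀ h : Lp ℝ 2 boxMeasure, Measurable fun w : Lp ℝ 2 boxMeasure → ℝ => w h :=
    fun h => measurable_pi_apply h
  have hpA : IndepFun (fun s => (signalHat f (τ j s) (t j s) ω).re)
      (fun s => (W j (cosLp ω) : S → ℝ) s) P :=
    (hm.indep_noise j).comp (Complex.measurable_re.comp hF) (hev (cosLp ω))
  have hqB : IndepFun (fun s => (signalHat f (τ j s) (t j s) ω).im)
      (fun s => (W j (sinLp ω) : S → ℝ) s) P :=
    (hm.indep_noise j).comp (Complex.measurable_im.comp hF) (hev (sinLp ω))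
  have hmom := noise_moments (σ := σ) (K := 2 * √K)
    (Lp.aestronglyMeasurable (W j (cosLp ω))).aemeasurable
    (Lp.aestronglyMeasurable (W j (sinLp ω))).aemeasurable
    (Complex.measurable_re.comp hFs).aemeasurable (Complex.measurable_im.comp hFs).aemeasurable
    (hm.whiteNoise j (cosLp ω)) (hm.whiteNoise j (sinLp ω))
    (by
      rw [Real.coe_toNNReal _ (by positivity), Real.coe_toNNReal _ (by positivity), ← mul_add,
        norm_cosLp_sq_add_norm_sinLp_sq, mul_one])
    (by
      filter_upwards [hm.ae_abs_τ_le_half hη hη' j] with s hs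
      exact (Complex.abs_re_le_norm _).trans (norm_signalHat_le hg hs _ _))
    (by
      filter_upwards [hm.ae_abs_τ_le_half hη hη' j] with s hs
      exact (Complex.abs_im_le_norm _).trans (norm_signalHat_le hg hs _ _))
    hpA hqB
  have hae : ∀ᵐ s ∂P, 2 * ((signalHat f (τ j s) (t j s) ω).re * (W j (cosLp ω) : S → ℝ) s -
      (signalHat f (τ j s) (t j s) ω).im * (W j (sinLp ω) : S → ℝ) s) +
      ((W j (cosLp ω) : S → ℝ) s ^ 2 + (W j (sinLp ω) : S → ℝ) s ^ 2) - σ ^ 2 =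
      noiseTerm f σ (τ j s) (t j s) (e j ω s) ω := by
    filter_upwards [(hm.noiseFourier j).ae_eq ω] with s hs
    rw [hs, noiseTerm_eq]
  obtain ⟨m1, m2, m3⟩ := hmom
  refine ⟨m1.ae_eq hae, ?_, ?_⟩
  · rw [← m2]
    exact (integral_congr_ae hae).symm
  · have e16 : 16 * (2 * √K) ^ 2 = 64 * K := by
      rw [mul_pow, Real.sq_sqrt hg.nonneg]; ring
    rw [e16] at m3
    refine le_trans (le_of_eq ?_) m3
    refine integral_congr_ae ?_
    filter_upwards [hae] with s hs
    simp only [Function.comp_apply]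
    rw [← hs]

lemma lintegral_meanNoise_sq_le [IsProbabilityMeasure P]
    (hm : NoisyDilationModel P f η σ M t τ W e) (hη : 0 < η) (hη' : η ^ 2 ≤ 1 / 12)
    (hM : 1 ≤ M) (hf : MemLp f 2) (hfc : HasCompactSupport f)
    (hg : HasBoundedDerivs (powerSpectrum f) g₁ g₂ g₃ K) (ω : ℝ) :
    ∫⁻ s, ‖meanNoise f σ t τ e ω s‖ₑ ^ 2 ∂P ≤ ENNReal.ofReal
      ((64 * K + 12 * gaussianFourthMoment + 6) * max (σ ^ 2) (σ ^ 4) / M) :=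
  lintegral_sq_average_le hM
    (fun j => (hm.noiseTerm_moments hη hη' hf hfc hg ω j).1)
    (hm.iIndepFun_noiseTerm hf hfc ω)
    (fun j => (hm.noiseTerm_moments hη hη' hf hfc hg ω j).2.1)
    (fun j => (hm.noiseTerm_moments hη hη' hf hfc hg ω j).2.2)

/-- The mean over `τ` of the smoothed data term of a dilated signal deviates by the smoothing bias
`O(L²)` from `dilationMean`. -/
lemma abs_dilationMean_sub_le (hη : 0 < η) (hη' : η ^ 2 ≤ 1 / 12)
    (hg : HasBoundedDerivs (powerSpectrum f) g₁ g₂ g₃ K) (L ω : ℝ) :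
    |dilationMean (powerSpectrum f) (√3 * η) ω - (√3 * η - -(√3 * η))⁻¹ *
      ∫ τ in (-(√3 * η))..(√3 * η), smoothedSignal (powerSpectrum f) g₁ L τ ω| ≤
      9 * K * (3 + |ω|) * L ^ 2 := by
  have hh := sqrt_three_mul_le_half hη'
  have hp : 0 < √3 * η := by positivity
  set h := √3 * η with hh0
  have hin : ∀ τ ∈ Set.uIoc (-h) h, |τ| ≤ 1 / 2 := by
    intro τ hτ
    rw [Set.uIoc_of_le (by linarith)] at hτ
    exact abs_le.2 ⟨by linarith [hτ.1], by linarith [hτ.2]⟩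
  have hc : Continuous fun τ => signalTerm (powerSpectrum f) g₁ τ ω ω :=
    hg.continuous_signalTerm.comp (f := fun τ : ℝ => (τ, ω, ω)) (by fun_prop)
  have hs : IntervalIntegrable (fun τ => smoothedSignal (powerSpectrum f) g₁ L τ ω)
      volume (-h) h := by
    rw [intervalIntegrable_iff]
    refine Measure.integrableOn_of_bounded (M := 4 * K * (3 + |ω|)) (by simp) ?_ ?_
    · exact ((hg.stronglyMeasurable_smoothedSignal L).comp_measurable
        (g := fun τ : ℝ => (τ, ω)) (by fun_prop)).aestronglyMeasurable
    · filter_upwards [ae_restrict_mem measurableSet_uIoc] with τ hτ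
      exact hg.abs_smoothedSignal_le (hin τ hτ) L ω
  have e2 : (h - -h)⁻¹ = (2 * h)⁻¹ := by ring_nf
  rw [hg.dilationMean_eq, e2, ← mul_sub,
    ← intervalIntegral.integral_sub (hc.intervalIntegrable _ _) hs, abs_mul,
    abs_of_pos (by positivity)]
  have hb := intervalIntegral.norm_integral_le_of_norm_le_const (a := -h) (b := h)
    (f := fun τ => signalTerm (powerSpectrum f) g₁ τ ω ω -
      smoothedSignal (powerSpectrum f) g₁ L τ ω) (C := 9 * K * (3 + |ω|) * L ^ 2) (fun τ hτ => by
        rw [norm_sub_rev]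
        exact hg.abs_smoothedSignal_sub_signalTerm_le (hin τ hτ) L ω)
  have e3 : |h - -h| = 2 * h := by
    rw [abs_of_pos (by linarith)]; ring
  rw [e3, Real.norm_eq_abs] at hb
  rw [inv_mul_le_iff₀ (by positivity)]
  linarith

/-- The variance of the averaged signal part is `O(η² / M)`. -/
lemma lintegral_signal_average_sq_le [IsProbabilityMeasure P]
    (hm : NoisyDilationModel P f η σ M t τ W e) (hη : 0 < η) (hη' : η ^ 2 ≤ 1 / 12)
    (hM : 1 ≤ M) (hg : HasBoundedDerivs (powerSpectrum f) g₁ g₂ g₃ K) {L : ℝ} (hL : 0 < L)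
    (ω : ℝ) :
    ∫⁻ s, ‖(M : ℝ)⁻¹ * ∑ j, (smoothedSignal (powerSpectrum f) g₁ L (τ j s) ω -
      (√3 * η - -(√3 * η))⁻¹ *
        ∫ τ in (-(√3 * η))..(√3 * η), smoothedSignal (powerSpectrum f) g₁ L τ ω)‖ₑ ^ 2 ∂P ≤
      ENNReal.ofReal ((5 * K * (3 + |ω|) * (1 + |ω| + L) * (√3 * η)) ^ 2 / M) := by
  have hp : 0 < √3 * η := by positivity
  set h := √3 * η with hh0
  set Y := fun τ => smoothedSignal (powerSpectrum f) g₁ L τ ω with hY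
  have hYm : Measurable Y := ((hg.stronglyMeasurable_smoothedSignal L).comp_measurable
        (g := fun τ : ℝ => (τ, ω)) (by fun_prop)).measurable
  set μ := (h - -h)⁻¹ * ∫ τ in (-h)..h, Y τ with hμ
  have hmean : ∀ j, ∫ s, Y (τ j s) ∂P = μ := fun j =>
    integral_comp_of_isUniform (hm.measurable_τ j) (by linarith) (hm.isUniform hη j) hYm
  have hY2 : ∀ j, MemLp (fun s => Y (τ j s)) 2 P := fun j =>
    MemLp.of_bound (hYm.comp (hm.measurable_τ j)).aestronglyMeasurable (4 * K * (3 + |ω|)) (by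
      filter_upwards [hm.ae_abs_τ_le_half hη hη' j] with s hs
      exact hg.abs_smoothedSignal_le hs L ω)
  refine lintegral_sq_average_le (X := fun j s => Y (τ j s) - μ) hM (fun j => ?_) ?_
    (fun j => ?_) (fun j => ?_)
  · exact (hY2 j).sub (memLp_const μ)
  · exact hm.indep.comp (fun _ p => Y p.2.1 - μ) (fun _ => by fun_prop)
  · rw [integral_sub ((hY2 j).integrable (by norm_num)) (integrable_const _), hmean]
    simp
  · -- the variance is at most the second moment about the undilated value
    have hvar : ∫ s, (Y (τ j s) - μ) ^ 2 ∂P = variance (fun s => Y (τ j s) - Y 0) P := by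
      rw [variance_sub_const (hY2 j).aestronglyMeasurable,
        variance_eq_integral (hY2 j).aestronglyMeasurable.aemeasurable, hmean]
    rw [hvar]
    refine (variance_le_expectation_sq
      ((hYm.comp (hm.measurable_τ j)).sub_const _).aestronglyMeasurable).trans ?_
    have hbd : ∀ᵐ s ∂P, ((fun s => Y (τ j s) - Y 0) ^ 2) s ≤
        (5 * K * (3 + |ω|) * (1 + |ω| + L) * h) ^ 2 := by
      filter_upwards [hm.ae_abs_τ_le hη j, hm.ae_abs_τ_le_half hη hη' j] with s h1 h2
      have hK := hg.nonneg
      have h3 := hg.abs_smoothedSignal_sub_le h2 hL ω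
      have h4 : |Y (τ j s) - Y 0| ≤ 5 * K * (3 + |ω|) * (1 + |ω| + L) * h :=
        h3.trans (mul_le_mul_of_nonneg_left h1 (by positivity))
      exact sq_le_sq' (abs_le.1 h4).1 (abs_le.1 h4).2
    refine (integral_mono_of_nonneg (Eventually.of_forall fun s => sq_nonneg _)
      (integrable_const _) hbd).trans_eq ?_
    simp

end NoisyDilationModel

end Model

/-! ### The smoothed noise -/

section SmoothedNoise

variable {S : Type*} [MeasurableSpace S] {P : Measure S} {N : ℝ → S → ℝ}

/-- A kernel of `L¹` norm `κ` maps a noise of variance at most `b` at every frequency to one of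
variance at most `κ² b`. -/
lemma lintegral_integral_mul_sq_le [SFinite P] (hN : Measurable (Function.uncurry N)) {b : ENNReal}
    (hb : ∀ x, ∫⁻ s, ‖N x s‖ₑ ^ 2 ∂P ≤ b) {k : ℝ → ℝ} (hk : Measurable k) :
    ∫⁻ s, ‖∫ x, N x s * k x‖ₑ ^ 2 ∂P ≤ (∫⁻ x, ‖k x‖ₑ) ^ 2 * b := by
  have hN' : Measurable fun p : S × ℝ => N p.2 p.1 := hN.comp measurable_swap
  have hNs : ∀ s, Measurable fun x => N x s := fun s => hN'.comp measurable_prodMk_left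
  have hNx : ∀ x, Measurable fun s => N x s := fun x => hN.comp measurable_prodMk_left
  have h1 : ∀ s, ‖∫ x, N x s * k x‖ₑ ^ 2 ≤
      (∫⁻ x, ‖k x‖ₑ) * ∫⁻ x, ‖k x‖ₑ * ‖N x s‖ₑ ^ 2 := by
    intro s
    refine le_trans ?_ (sq_lintegral_mul_le hk.enorm (hNs s).enorm.aemeasurable)
    gcongr
    refine (enorm_integral_le_lintegral_enorm _).trans_eq (lintegral_congr fun x => ?_)
    rw [enorm_mul, mul_comm]
  calc ∫⁻ s, ‖∫ x, N x s * k x‖ₑ ^ 2 ∂P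
      ≤ ∫⁻ s, (∫⁻ x, ‖k x‖ₑ) * (∫⁻ x, ‖k x‖ₑ * ‖N x s‖ₑ ^ 2) ∂P := lintegral_mono h1
    _ = (∫⁻ x, ‖k x‖ₑ) * ∫⁻ s, (∫⁻ x, ‖k x‖ₑ * ‖N x s‖ₑ ^ 2) ∂P := by
        refine lintegral_const_mul _ (Measurable.lintegral_prod_right' (f := fun p : S × ℝ =>
          ‖k p.2‖ₑ * ‖N p.2 p.1‖ₑ ^ 2) (by fun_prop))
    _ = (∫⁻ x, ‖k x‖ₑ) * ∫⁻ x, ∫⁻ s, ‖k x‖ₑ * ‖N x s‖ₑ ^ 2 ∂P := by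
        rw [lintegral_lintegral_swap]
        exact Measurable.aemeasurable (f := fun p : S × ℝ =>
          ‖k p.2‖ₑ * ‖N p.2 p.1‖ₑ ^ 2) (by fun_prop)
    _ ≤ (∫⁻ x, ‖k x‖ₑ) * ∫⁻ x, ‖k x‖ₑ * b := by
        gcongr with x
        rw [lintegral_const_mul _ ((hNx x).enorm.pow_const 2)]
        gcongr
        exact hb x
    _ = (∫⁻ x, ‖k x‖ₑ) ^ 2 * b := by
        rw [lintegral_mul_const _ hk.enorm]
        ring

/-- A noise of bounded variance is almost surely integrable against the Gaussian weight. -/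
lemma ae_integrable_mul_weight [SFinite P] (hN : Measurable (Function.uncurry N)) {b : ENNReal}
    (hbt : b ≠ ⊤) (hb : ∀ x, ∫⁻ s, ‖N x s‖ₑ ^ 2 ∂P ≤ b) {L : ℝ} (hL : 0 < L) :
    ∀ᵐ s ∂P, Integrable fun x => N x s * weight L x := by
  have hN' : Measurable fun p : S × ℝ => N p.2 p.1 := hN.comp measurable_swap
  have hNs : ∀ s, Measurable fun x => N x s := fun s => hN'.comp measurable_prodMk_left
  have hNx : ∀ x, Measurable fun s => N x s := fun x => hN.comp measurable_prodMk_left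
  have hw : Measurable (weight L) := (continuous_weight L).measurable
  have hwt : ∫⁻ x, ‖weight L x‖ₑ ≠ ⊤ := (integrable_weight hL).2.ne
  have hjm : Measurable fun p : S × ℝ => ‖N p.2 p.1‖ₑ ^ 2 * ‖weight L p.2‖ₑ := by fun_prop
  have hfin : ∫⁻ s, (∫⁻ x, ‖N x s‖ₑ ^ 2 * ‖weight L x‖ₑ) ∂P ≠ ⊤ := by
    rw [lintegral_lintegral_swap hjm.aemeasurable]
    refine ne_top_of_le_ne_top (ENNReal.mul_ne_top hbt hwt) ?_
    rw [← lintegral_const_mul _ hw.enorm]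
    refine lintegral_mono fun x => ?_
    rw [lintegral_mul_const _ ((hNx x).enorm.pow_const 2)]
    gcongr
    exact hb x
  filter_upwards [ae_lt_top hjm.lintegral_prod_right' hfin] with s hs
  refine ⟨((hNs s).mul hw).aestronglyMeasurable, ?_⟩
  -- `|N| ≤ 1 + |N|²`
  have hle : ∀ x, ‖N x s * weight L x‖ₑ ≤ ‖weight L x‖ₑ + ‖N x s‖ₑ ^ 2 * ‖weight L x‖ₑ := by
    intro x
    rw [enorm_mul, ← one_add_mul]
    gcongr
    rcases le_total ‖N x s‖ₑ 1 with h | h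
    · exact h.trans le_self_add
    · exact (le_self_pow₀ h two_ne_zero).trans le_add_self
  refine (lintegral_mono hle).trans_lt ?_
  rw [lintegral_add_left hw.enorm]
  exact ENNReal.add_lt_top.2 ⟨hwt.lt_top, hs⟩

end SmoothedNoise

/-! ### The error of the estimator -/

/-- The difference between `dilationMean` and the data term `3 G(ω) + ω G'(ω)`, for almost every
sample point: the estimation error before the Neumann series is applied. -/
def residual {S : Type*} (f g₁ : ℝ → ℝ) (η σ L : ℝ) {M : ℕ} (t τ : Fin M → S → ℝ)
    (e : Fin M → ℝ → S → ℂ) (ω : ℝ) (s : S) : ℝ :=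
  dilationMean (powerSpectrum f) (√3 * η) ω -
    ((M : ℝ)⁻¹ * ∑ j, smoothedSignal (powerSpectrum f) g₁ L (τ j s) ω +
      ∫ x, meanNoise f σ t τ e x s * kern L ω x)

lemma enorm_sq_sub_sub_le (a b c : ℝ) :
    ‖a - b - c‖ₑ ^ 2 ≤ 3 * (‖a‖ₑ ^ 2 + ‖b‖ₑ ^ 2 + ‖c‖ₑ ^ 2) := by
  have h : ∀ x : ℝ, ‖x‖ₑ ^ 2 = ENNReal.ofReal (x ^ 2) := fun x => by
    rw [← sq_abs, ENNReal.ofReal_pow (abs_nonneg _), ← Real.enorm_eq_ofReal_abs]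
  have h3 : (3 : ENNReal) = ENNReal.ofReal 3 := by norm_num
  rw [h, h, h, h, h3, ← ENNReal.ofReal_add (sq_nonneg _) (sq_nonneg _),
    ← ENNReal.ofReal_add (by positivity) (sq_nonneg _), ← ENNReal.ofReal_mul (by norm_num)]
  refine ENNReal.ofReal_le_ofReal ?_
  nlinarith [sq_nonneg (a + b), sq_nonneg (a + c), sq_nonneg (b - c)]

section Model

variable {S : Type*} [MeasurableSpace S] {P : Measure S} {f : ℝ → ℝ} {η σ : ℝ} {M : ℕ}
  {t τ : Fin M → S → ℝ} {W : Fin M → (Lp ℝ 2 boxMeasure →ₗ[ℝ] Lp ℝ 2 P)}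
  {e : Fin M → ℝ → S → ℂ} {g₁ g₂ g₃ : ℝ → ℝ} {K : ℝ}

/-- The constant of the pointwise error bound on the frequencies `|ω| ≤ R`, for filter widths up to
`L₀` and a power spectrum with derivatives bounded by `K`; the three summands belong to the
smoothing bias, the dilations and the noise. -/
def errorConst (K R L₀ : ℝ) : ℝ :=
  3 * ((9 * K * (3 + R)) ^ 2 + 3 * (5 * K * (3 + R) * (1 + R + L₀)) ^ 2 +
    (3 * L₀ + R) ^ 2 * (64 * K + 12 * gaussianFourthMoment + 6))

namespace NoisyDilationModel

lemma measurable_residual (hm : NoisyDilationModel P f η σ M t τ W e) (hf : MemLp f 2)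
    (hfc : HasCompactSupport f) (hg : HasBoundedDerivs (powerSpectrum f) g₁ g₂ g₃ K) (L : ℝ) :
    Measurable (Function.uncurry (residual f g₁ η σ L t τ e)) := by
  have h1 : Measurable (dilationMean (powerSpectrum f) (√3 * η)) := by
    have := hg.continuous
    have hc : Continuous (dilationMean (powerSpectrum f) (√3 * η)) := by
      unfold dilationMean; fun_prop
    exact hc.measurable
  have h2 : ∀ j, Measurable fun p : ℝ × S =>
      smoothedSignal (powerSpectrum f) g₁ L (τ j p.2) p.1 := fun j => by
    have := hm.measurable_τ j
    exact (hg.stronglyMeasurable_smoothedSignal L).measurable.comp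
      (f := fun p : ℝ × S => (τ j p.2, p.1)) (by fun_prop)
  have h3 : Measurable fun q : (ℝ × S) × ℝ =>
      meanNoise f σ t τ e q.2 q.1.2 * kern L q.1.1 q.2 := by
    have hN := (hm.measurable_meanNoise hf hfc).comp
      (f := fun q : (ℝ × S) × ℝ => (q.2, q.1.2)) (by fun_prop)
    have hk := (continuous_uncurry_kern L).measurable.comp
      (f := fun q : (ℝ × S) × ℝ => (q.1.1, q.2)) (by fun_prop)
    exact hN.mul hk
  have h4 := (h3.stronglyMeasurable.integral_prod_right' (ν := volume)).measurable
  have h5 : Measurable fun p : ℝ × S => ∑ j, smoothedSignal (powerSpectrum f) g₁ L (τ j p.2) p.1 :=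
    Finset.measurable_sum _ fun j _ => h2 j
  exact (h1.comp measurable_fst).sub ((h5.const_mul _).add h4)

/-- The mean square error before inversion splits into the smoothing bias, the variance due to the
dilations, and the variance due to the noise. -/
lemma lintegral_residual_sq_le [IsProbabilityMeasure P]
    (hm : NoisyDilationModel P f η σ M t τ W e) (hη : 0 < η) (hη' : η ^ 2 ≤ 1 / 12)
    (hM : 1 ≤ M) (hf : MemLp f 2) (hfc : HasCompactSupport f)
    (hg : HasBoundedDerivs (powerSpectrum f) g₁ g₂ g₃ K) {L L₀ : ℝ} (hL : 0 < L) (hL₀ : L ≤ L₀)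
    {R ω : ℝ} (hω : |ω| ≤ R) :
    ∫⁻ s, ‖residual f g₁ η σ L t τ e ω s‖ₑ ^ 2 ∂P ≤ ENNReal.ofReal
      (errorConst K R L₀ * (η ^ 2 / M + L ^ 4 + max (σ ^ 2) (σ ^ 4) / (L ^ 2 * M))) := by
  have hM' : (0 : ℝ) < M := by exact_mod_cast hM
  have hK := hg.nonneg
  have hR : 0 ≤ R := (abs_nonneg ω).trans hω
  have hm4 := gaussianFourthMoment_nonneg
  set μ := (√3 * η - -(√3 * η))⁻¹ *
    ∫ τ in (-(√3 * η))..(√3 * η), smoothedSignal (powerSpectrum f) g₁ L τ ω with hμ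
  set a := dilationMean (powerSpectrum f) (√3 * η) ω - μ with ha
  set b : S → ℝ := fun s =>
    (M : ℝ)⁻¹ * ∑ j, (smoothedSignal (powerSpectrum f) g₁ L (τ j s) ω - μ) with hb
  set n : S → ℝ := fun s => ∫ x, meanNoise f σ t τ e x s * kern L ω x with hn
  set Q := (64 * K + 12 * gaussianFourthMoment + 6) with hQ
  set m := max (σ ^ 2) (σ ^ 4) with hmax
  have hm0 : 0 ≤ m := (sq_nonneg σ).trans (le_max_left _ _)
  have hdec : ∀ s, residual f g₁ η σ L t τ e ω s = a - b s - n s := by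
    intro s
    simp only [residual, ha, hb, hn, Finset.sum_sub_distrib, Finset.sum_const, Finset.card_univ,
      Fintype.card_fin, nsmul_eq_mul]
    field_simp
    ring
  have hbm : Measurable b := by
    refine Measurable.const_mul (Finset.measurable_sum _ fun j _ => ?_) _
    have := hm.measurable_τ j
    exact ((hg.stronglyMeasurable_smoothedSignal L).measurable.comp
      (f := fun s => (τ j s, ω)) (by fun_prop)).sub_const _
  have Ba : ‖a‖ₑ ^ 2 ≤ ENNReal.ofReal ((9 * K * (3 + R)) ^ 2 * L ^ 4) := by
    have h1 : |a| ≤ 9 * K * (3 + R) * L ^ 2 := by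
      refine (abs_dilationMean_sub_le hη hη' hg L ω).trans ?_
      gcongr
    rw [Real.enorm_eq_ofReal_abs, ← ENNReal.ofReal_pow (abs_nonneg _)]
    refine ENNReal.ofReal_le_ofReal ?_
    calc |a| ^ 2 ≤ (9 * K * (3 + R) * L ^ 2) ^ 2 := by gcongr
      _ = _ := by ring
  have Bb : ∫⁻ s, ‖b s‖ₑ ^ 2 ∂P ≤
      ENNReal.ofReal (3 * (5 * K * (3 + R) * (1 + R + L₀)) ^ 2 * (η ^ 2 / M)) := by
    refine (hm.lintegral_signal_average_sq_le hη hη' hM hg hL ω).trans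
      (ENNReal.ofReal_le_ofReal ?_)
    calc (5 * K * (3 + |ω|) * (1 + |ω| + L) * (√3 * η)) ^ 2 / M
        ≤ (5 * K * (3 + R) * (1 + R + L₀) * (√3 * η)) ^ 2 / M := by gcongr
      _ = _ := by
        rw [mul_pow _ (√3 * η), mul_pow √3, Real.sq_sqrt (by norm_num)]
        ring
  have Bn : ∫⁻ s, ‖n s‖ₑ ^ 2 ∂P ≤ ENNReal.ofReal ((3 * L₀ + R) ^ 2 * Q * (m / (L ^ 2 * M))) := by
    refine (lintegral_integral_mul_sq_le (hm.measurable_meanNoise hf hfc)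
      (hm.lintegral_meanNoise_sq_le hη hη' hM hf hfc hg) (continuous_kern L ω).measurable).trans ?_
    have hk : ∫⁻ x, ‖kern L ω x‖ₑ ≤ ENNReal.ofReal ((3 * L₀ + R) / L) := by
      rw [← ofReal_integral_norm_eq_lintegral_enorm (integrable_kern hL ω)]
      refine ENNReal.ofReal_le_ofReal ((integral_abs_kern_le hL ω).trans ?_)
      rw [le_div_iff₀ hL, add_mul, div_mul_cancel₀ _ hL.ne']
      linarith
    have hL₀' : 0 ≤ L₀ := hL.le.trans hL₀
    refine (mul_le_mul_left (pow_le_pow_left₀ zero_le hk 2) _).trans_eq ?_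
    rw [← ENNReal.ofReal_pow (by positivity), ← ENNReal.ofReal_mul (by positivity), ← hQ, ← hmax]
    congr 1
    field_simp
  calc ∫⁻ s, ‖residual f g₁ η σ L t τ e ω s‖ₑ ^ 2 ∂P
      ≤ ∫⁻ s, 3 * (‖a‖ₑ ^ 2 + ‖b s‖ₑ ^ 2 + ‖n s‖ₑ ^ 2) ∂P := by
        refine lintegral_mono fun s => ?_
        rw [hdec]
        exact enorm_sq_sub_sub_le _ _ _
    _ = 3 * (‖a‖ₑ ^ 2 + ∫⁻ s, ‖b s‖ₑ ^ 2 ∂P + ∫⁻ s, ‖n s‖ₑ ^ 2 ∂P) := by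
        rw [lintegral_const_mul' _ _ (by norm_num),
          lintegral_add_left (f := fun s => ‖a‖ₑ ^ 2 + ‖b s‖ₑ ^ 2) (by fun_prop),
          lintegral_add_left measurable_const]
        simp
    _ ≤ ENNReal.ofReal 3 * (ENNReal.ofReal ((9 * K * (3 + R)) ^ 2 * L ^ 4) +
          ENNReal.ofReal (3 * (5 * K * (3 + R) * (1 + R + L₀)) ^ 2 * (η ^ 2 / M)) +
          ENNReal.ofReal ((3 * L₀ + R) ^ 2 * Q * (m / (L ^ 2 * M)))) := by
        rw [ENNReal.ofReal_ofNat]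
        gcongr
    _ ≤ _ := by
        have p1 : 0 ≤ (9 * K * (3 + R)) ^ 2 := by positivity
        have p2 : 0 ≤ 3 * (5 * K * (3 + R) * (1 + R + L₀)) ^ 2 := by positivity
        have p3 : 0 ≤ (3 * L₀ + R) ^ 2 * Q := by positivity
        have q1 : 0 ≤ L ^ 4 := by positivity
        have q2 : 0 ≤ η ^ 2 / (M : ℝ) := by positivity
        have q3 : 0 ≤ m / (L ^ 2 * M) := by positivity
        rw [errorConst, ← hQ]
        generalize (9 * K * (3 + R)) ^ 2 = x1 at *
        generalize 3 * (5 * K * (3 + R) * (1 + R + L₀)) ^ 2 = x2 at *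
        generalize (3 * L₀ + R) ^ 2 * Q = x3 at *
        generalize L ^ 4 = y1 at *
        generalize η ^ 2 / (M : ℝ) = y2 at *
        generalize m / (L ^ 2 * M) = y3 at *
        rw [← ENNReal.ofReal_add (mul_nonneg p1 q1) (mul_nonneg p2 q2),
          ← ENNReal.ofReal_add (add_nonneg (mul_nonneg p1 q1) (mul_nonneg p2 q2))
            (mul_nonneg p3 q3), ← ENNReal.ofReal_mul (by norm_num), mul_assoc 3]
        refine ENNReal.ofReal_le_ofReal (mul_le_mul_of_nonneg_left ?_ (by norm_num))
        linarith [mul_nonneg p1 q2, mul_nonneg p1 q3, mul_nonneg p2 q1, mul_nonneg p2 q3,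
          mul_nonneg p3 q1, mul_nonneg p3 q2]

/-- Almost surely the estimator is well defined, and its error is the Neumann series of the
residual. -/
lemma ae_estimatorDefined_and_error_eq [IsProbabilityMeasure P]
    (hm : NoisyDilationModel P f η σ M t τ W e) (hη : 0 < η) (hη' : η ^ 2 ≤ 1 / 12)
    (hM : 1 ≤ M) (hf : MemLp f 2) (hfc : HasCompactSupport f)
    (hg : HasBoundedDerivs (powerSpectrum f) g₁ g₂ g₃ K) {L : ℝ} (hL : 0 < L) :
    ∀ᵐ s ∂P, EstimatorDefined η σ L (obsHat f t τ e s) ∧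
      ∀ ω, powerSpectrum f ω - estimator η σ L (obsHat f t τ e s) ω =
        ∑' i, neumannCoeff η i * residual f g₁ η σ L t τ e (neumannFreq η i ω) s := by
  have hτ : ∀ᵐ s ∂P, ∀ j, |τ j s| ≤ 1 / 2 := ae_all_iff.2 fun j => hm.ae_abs_τ_le_half hη hη' j
  have hNi := ae_integrable_mul_weight (hm.measurable_meanNoise hf hfc) ENNReal.ofReal_ne_top
    (hm.lintegral_meanNoise_sq_le hη hη' hM hf hfc hg) hL
  have hM' : (0 : ℝ) < M := by exact_mod_cast hM
  filter_upwards [hτ, hNi] with s hs hN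
  have hgc := hg.continuous
  set D := debiasedMean σ (obsHat f t τ e s) with hD
  set u : Fin M → ℝ → ℝ := fun j x => (1 - τ j s) ^ 2 * powerSpectrum f ((1 - τ j s) * x) with hu
  have huc : ∀ j, Continuous (u j) := fun j => by simp only [hu]; fun_prop
  have hNm : Measurable fun x => meanNoise f σ t τ e x s :=
    (hm.measurable_meanNoise hf hfc).comp (f := fun x : ℝ => (x, s)) (by fun_prop)
  have hDeq : ∀ x, D x = (M : ℝ)⁻¹ * ∑ j, u j x + meanNoise f σ t τ e x s := by
    intro x
    simp only [hD, debiasedMean, meanNoise, noiseTerm, hu, obsHat, Finset.sum_sub_distrib,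
      Finset.sum_const, Finset.card_univ, Fintype.card_fin, nsmul_eq_mul]
    have e1 : ∀ j, hat (dilatedSignal f (τ j s) (t j s)) x = signalHat f (τ j s) (t j s) x :=
      fun j => hat_dilatedSignal f (by linarith [(abs_le.1 (hs j)).2]) _ _
    simp_rw [e1, norm_signalHat_sq]
    rw [mul_sub, mul_sub, inv_mul_cancel_left₀ hM'.ne']
    ring
  have hui : ∀ j, Integrable fun x => u j x * weight L x := fun j => by
    refine (integrable_weight hL).bdd_mul (c := 4 * K) (huc j).aestronglyMeasurable
      (Eventually.of_forall fun x => ?_)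
    obtain ⟨hl, hr⟩ := abs_le.1 (hs j)
    rw [Real.norm_eq_abs, abs_mul, abs_of_nonneg (sq_nonneg _)]
    exact mul_le_mul (by nlinarith) (hg.b0 _) (abs_nonneg _) (by norm_num)
  have hDm : AEStronglyMeasurable D := by
    have : D = fun x => (M : ℝ)⁻¹ * ∑ j, u j x + meanNoise f σ t τ e x s := funext hDeq
    rw [this]
    exact ((continuous_const.mul (continuous_finsetSum _ fun j _ => huc j)).measurable.add
      hNm).aestronglyMeasurable
  have hDi : Integrable fun x => D x * weight L x := by
    have h1 : Integrable fun x => ∑ j, u j x * weight L x :=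
      integrable_finsetSum _ fun j _ => hui j
    refine ((h1.const_mul (M : ℝ)⁻¹).add hN).congr (Eventually.of_forall fun x => ?_)
    simp only [Pi.add_apply, hDeq, ← Finset.sum_mul]
    ring
  set V : ℝ → ℝ := fun ω => ∫ x, D x * kern L ω x with hV
  have hdata : dataTerm η σ L (obsHat f t τ e s) = fun ω => c1 η * dilate (c2 η) V ω := by
    have hVeq : (fun ω' => 3 * smoothedMean σ L (obsHat f t τ e s) ω' +
        ω' * deriv (smoothedMean σ L (obsHat f t τ e s)) ω') = V :=
      funext fun ω => three_mul_convolution_add hL hDm hDi ω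
    unfold dataTerm
    rw [hVeq]
  have hVsum : ∀ ω, Summable fun i => neumannCoeff η i * V (neumannFreq η i ω) := fun ω =>
    summable_neumann hη hη' fun ω' hω' => abs_integral_mul_kern_le hL hDi hω'
  have hVres : ∀ ω, dilationMean (powerSpectrum f) (√3 * η) ω - V ω =
      residual f g₁ η σ L t τ e ω s := by
    intro ω
    have e1 : ∀ x, D x * kern L ω x =
        (M : ℝ)⁻¹ * ∑ j, u j x * kern L ω x + meanNoise f σ t τ e x s * kern L ω x := fun x => by
      rw [hDeq, ← Finset.sum_mul]; ring
    have i1 : ∀ j, Integrable fun x => u j x * kern L ω x := fun j =>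
      integrable_mul_kern hL (huc j).aestronglyMeasurable (hui j) ω
    have i2 : Integrable fun x => (M : ℝ)⁻¹ * ∑ j, u j x * kern L ω x :=
      (integrable_finsetSum _ fun j _ => i1 j).const_mul _
    rw [residual, hV]
    simp_rw [e1]
    rw [integral_add i2 (integrable_mul_kern hL hNm.aestronglyMeasurable hN ω),
      integral_const_mul, integral_finsetSum _ fun j _ => i1 j]
    simp_rw [hu, hg.integral_mul_kern_dilated (hs _) hL]
  refine ⟨⟨convolutionExists_gaussianFilter hL hDm hDi, fun ω =>
    (hasDerivAt_convolution_gaussianFilter hL hDm hDi ω).differentiableAt, fun ω => ?_⟩,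
    fun ω => ?_⟩
  · rw [hdata]
    simp_rw [iterate_dilate_eq_neumann]
    exact hVsum ω
  · have hgs := hasSum_neumann_dilationMean hη hη' hgc ω
    rw [estimator, invOneSubDilate, hdata]
    simp_rw [iterate_dilate_eq_neumann, ← hVres, mul_sub]
    rw [hgs.summable.tsum_sub (hVsum ω), hgs.tsum_eq]

end NoisyDilationModel

end Model

section MeanSquareError

variable {S : Type*} [MeasurableSpace S] {P : Measure S} {f : ℝ → ℝ} {η σ : ℝ} {M : ℕ}
  {t τ : Fin M → S → ℝ} {W : Fin M → (Lp ℝ 2 boxMeasure →ₗ[ℝ] Lp ℝ 2 P)}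
  {e : Fin M → ℝ → S → ℂ} {g₁ g₂ g₃ : ℝ → ℝ} {K : ℝ}

/-- Tonelli transfers the frequency-wise bound on the residual to the mean square error on `Ω`. -/
lemma NoisyDilationModel.lintegral_error_sq_le [IsProbabilityMeasure P]
    (hm : NoisyDilationModel P f η σ M t τ W e) (hη : 0 < η) (hη' : η ^ 2 ≤ 1 / 12)
    (hM : 1 ≤ M) (hf : MemLp f 2) (hfc : HasCompactSupport f)
    (hg : HasBoundedDerivs (powerSpectrum f) g₁ g₂ g₃ K) {L L₀ : ℝ} (hL : 0 < L) (hL₀ : L ≤ L₀)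
    {R : ℝ} {Ω : Set ℝ} (hΩ : ∀ ω ∈ Ω, |ω| ≤ R) :
    ∫⁻ s, eLpNorm (fun ω => powerSpectrum f ω - estimator η σ L (obsHat f t τ e s) ω) 2
        (volume.restrict Ω) ^ 2 ∂P ≤
      ENNReal.ofReal
        (errorConst K R L₀ * (η ^ 2 / M + L ^ 4 + max (σ ^ 2) (σ ^ 4) / (L ^ 2 * M))) *
        volume Ω := by
  set b := ENNReal.ofReal
    (errorConst K R L₀ * (η ^ 2 / M + L ^ 4 + max (σ ^ 2) (σ ^ 4) / (L ^ 2 * M))) with hb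
  set r := residual f g₁ η σ L t τ e with hr
  set c : ℕ → ENNReal := fun i => ENNReal.ofReal (neumannCoeff η i) with hc
  have hrm : Measurable (Function.uncurry r) := hm.measurable_residual hf hfc hg L
  have hrf : ∀ i, Measurable fun p : S × ℝ => c i * ‖r (neumannFreq η i p.2) p.1‖ₑ ^ 2 := by
    intro i
    have h1 : Measurable (neumannFreq η i) := by unfold neumannFreq; fun_prop
    have h2 : Measurable fun p : S × ℝ => r (neumannFreq η i p.2) p.1 :=
      hrm.comp (f := fun p : S × ℝ => (neumannFreq η i p.2, p.1)) (by fun_prop)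
    fun_prop
  have hsumc : ∑' i, c i ≤ 1 := by
    rw [← ENNReal.ofReal_tsum_of_nonneg (neumannCoeff_nonneg hη hη') (summable_neumannCoeff hη hη')]
    exact ENNReal.ofReal_le_one.2 (tsum_neumannCoeff_le_one hη hη')
  have hae : ∀ᵐ s ∂P,
      eLpNorm (fun ω => powerSpectrum f ω - estimator η σ L (obsHat f t τ e s) ω) 2
        (volume.restrict Ω) ^ 2 ≤
      ∫⁻ ω in Ω, ∑' i, c i * ‖r (neumannFreq η i ω) s‖ₑ ^ 2 := by
    filter_upwards [hm.ae_estimatorDefined_and_error_eq hη hη' hM hf hfc hg hL] with s hs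
    have h2 := eLpNorm_nnreal_pow_eq_lintegral (p := 2) (μ := volume.restrict Ω)
      (f := fun ω => powerSpectrum f ω - estimator η σ L (obsHat f t τ e s) ω) (by norm_num)
    simp only [NNReal.coe_ofNat, ENNReal.coe_ofNat, ENNReal.rpow_ofNat] at h2
    rw [h2]
    refine lintegral_mono fun ω => ?_
    rw [hs.2 ω]
    exact enorm_sq_tsum_neumann_le hη hη' (fun ω => r ω s) ω
  calc _ ≤ ∫⁻ s, (∫⁻ ω in Ω, ∑' i, c i * ‖r (neumannFreq η i ω) s‖ₑ ^ 2) ∂P :=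
        lintegral_mono_ae hae
    _ = ∫⁻ ω in Ω, ∫⁻ s, (∑' i, c i * ‖r (neumannFreq η i ω) s‖ₑ ^ 2) ∂P :=
        lintegral_lintegral_swap (f := fun s ω => ∑' i, c i * ‖r (neumannFreq η i ω) s‖ₑ ^ 2)
          (Measurable.tsum hrf).aemeasurable
    _ ≤ ∫⁻ _ω in Ω, b := by
        refine setLIntegral_mono measurable_const fun ω hω => ?_
        rw [lintegral_tsum (f := fun i s => c i * ‖r (neumannFreq η i ω) s‖ₑ ^ 2)
          fun i => ((hrf i).comp measurable_prodMk_right).aemeasurable]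
        calc ∑' i, ∫⁻ s, c i * ‖r (neumannFreq η i ω) s‖ₑ ^ 2 ∂P ≤ ∑' i, c i * b := by
              refine ENNReal.tsum_le_tsum fun i => ?_
              rw [lintegral_const_mul' _ _ ENNReal.ofReal_ne_top]
              gcongr
              -- the Neumann series only looks at frequencies of modulus at most `|ω|`
              exact hm.lintegral_residual_sq_le hη hη' hM hf hfc hg hL hL₀
                ((abs_neumannFreq_le hη hη' i ω).trans (hΩ ω hω))
          _ ≤ b := by
              rw [ENNReal.tsum_mul_right]
              exact mul_le_of_le_one_left' hsumc
    _ = b * volume Ω := by simp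

end MeanSquareError

end DilationMRA

end

theorem theorem2 (f : ℝ → ℝ)
    (hf : MeasureTheory.MemLp f 2 MeasureTheory.volume) (hfc : HasCompactSupport f)
    (hP : ContDiff ℝ 3 (DilationMRA.powerSpectrum f))
    (hw : ∀ k : ℕ, k = 2 ∨ k = 3 →
      MeasureTheory.MemLp
        (fun ω : ℝ => ω ^ k * DilationMRA.maxDeriv (DilationMRA.powerSpectrum f) k ω)
        2 MeasureTheory.volume)
    (Ω : Set ℝ) (hΩ : Ω.OrdConnected) (hΩb : Bornology.IsBounded Ω)
    (L₀ : ℝ) (hL₀ : 0 < L₀) :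
    ∃ C : ℝ, 0 < C ∧
      ∀ (η σ L : ℝ) (M : ℕ), 0 < η → η ^ 2 ≤ 1 / 12 → 0 ≤ σ → 0 < L → L ≤ L₀ → 1 ≤ M →
      ∀ (S : Type*) [MeasurableSpace S] (P : MeasureTheory.Measure S)
        [MeasureTheory.IsProbabilityMeasure P] (t τ : Fin M → S → ℝ)
        (W : Fin M → (MeasureTheory.Lp ℝ 2 DilationMRA.boxMeasure →ₗ[ℝ] MeasureTheory.Lp ℝ 2 P))
        (e : Fin M → ℝ → S → ℂ),
        DilationMRA.NoisyDilationModel P f η σ M t τ W e →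
        (∀ᵐ s ∂P, DilationMRA.EstimatorDefined η σ L (DilationMRA.obsHat f t τ e s)) ∧
        ∫⁻ s, MeasureTheory.eLpNorm
            (fun ω => DilationMRA.powerSpectrum f ω -
              DilationMRA.estimator η σ L (DilationMRA.obsHat f t τ e s) ω)
            2 (MeasureTheory.volume.restrict Ω) ^ 2 ∂P
          ≤ ENNReal.ofReal
              (C * (η ^ 2 / M + L ^ 4 + max (σ ^ 2) (σ ^ 4) / (L ^ 2 * M))) := by
  obtain ⟨g₁, g₂, g₃, K, hg⟩ := DilationMRA.exists_hasBoundedDerivs hf hfc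
  obtain ⟨R, hR⟩ := hΩb.exists_norm_le
  have hvol : MeasureTheory.volume Ω ≠ ⊤ := hΩb.measure_lt_top.ne
  have hK : 0 ≤ DilationMRA.errorConst K R L₀ := by
    have := hg.nonneg
    have := DilationMRA.gaussianFourthMoment_nonneg
    unfold DilationMRA.errorConst
    positivity
  refine ⟨DilationMRA.errorConst K R L₀ * (MeasureTheory.volume Ω).toReal + 1, by positivity,
    fun η σ L M hη hη' _ hL hLL₀ hM S _ P _ t τ W e hm => ⟨?_, ?_⟩⟩
  · filter_upwards [hm.ae_estimatorDefined_and_error_eq hη hη' hM hf hfc hg hL] with s hs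
    exact hs.1
  · refine (hm.lintegral_error_sq_le hη hη' hM hf hfc hg hL hLL₀ hR).trans ?_
    rw [← ENNReal.ofReal_toReal hvol, ← ENNReal.ofReal_mul' ENNReal.toReal_nonneg]
    refine ENNReal.ofReal_le_ofReal ?_
    have hm0 : 0 ≤ max (σ ^ 2) (σ ^ 4) := (sq_nonneg σ).trans (le_max_left _ _)
    have hq : 0 ≤ η ^ 2 / (M : ℝ) + L ^ 4 + max (σ ^ 2) (σ ^ 4) / (L ^ 2 * M) := by positivity
    rw [ENNReal.toReal_ofReal ENNReal.toReal_nonneg]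
    linarith
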